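/- Let $p=(p_k)_{k\in\mathbb N}$ satisfy $0<p_k<1$, put $q_k:=1-p_k$, and let $X_k(\omega):=\omega_k$ be the coordinates on $\Omega=\{-1,+1\}^{\mathbb N}$ with its product $\sigma$-algebra and the probability measure $P=\bigotimes_{k}(p_k\delta_{+1}+q_k\delta_{-1})$. Put $Y_k:=(X_k-p_k+q_k)/(2\sqrt{p_kq_k})$. For $n\ge 1$ and a square-summable symmetric $f:\mathbb N^n\to\mathbb R$ that vanishes at all points with two equal coordinates, let $J_n(f):=\sum_{(i_1,\dots,i_n)\in\mathbb N^n}f(i_1,\dots,i_n)Y_{i_1}\cdots Y_{i_n}$ (convergence in $L^2(\Omega)$). Every $G\in L^2(\Omega)$ has a unique representation $G=\mathbb E[G]+\sum_{n\ge1}J_n(g_n)$ with such kernels $g_n$, the series converging in $L^2(\Omega)$; if $\mathbb E[G]=0$, put $L^{-1}G:=-\sum_{n\ge1}\frac1n J_n(g_n)$. For a random variable $G$ let $D_kG(\omega):=\sqrt{p_kq_k}\,\bigl(G(\omega^k_+)-G(\omega^k_-)\bigr)$, where $\omega^k_\pm$ is $\omega$ with its $k$-th coordinate replaced by $\pm1$,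 and $DG:=(D_kG)_{k\in\mathbb N}$. Let $\operatorname{dom}(D)$ be the set of $G\in L^2(\Omega)$ with $\mathbb E\bigl[\sum_k (D_kG)^2\bigr]<\infty$. Let $F\in\operatorname{dom}(D)$ take values in $\mathbb N_0$, and let $\mathrm{Po}(\lambda)$ be a Poisson random variable with mean $\lambda>0$. Then, with $d_{TV}(F,\mathrm{Po}(\lambda)):=\sup_{A\subseteq\mathbb N_0}|P(F\in A)-P(\mathrm{Po}(\lambda)\in A)|$, $$ \begin{aligned} d_{TV}(F,\mathrm{Po}(\lambda))\le{}&\Bigl(1\wedge\sqrt{\tfrac{2}{e\lambda}}\Bigr)\,|\lambda-\mathbb E[F]|+\frac{1-e^{-\lambda}}{\lambda}\,\mathbb E\Bigl[\bigl|\lambda-\langle DF,-DL^{-1}(F-\mathbb E[F])\rangle_{\ell^2(\mathbb N)}\bigr|\Bigr]\\ &+\frac{1-e^{-\lambda}}{\lambda}\sum_{k=1}^\infty\frac{1}{\sqrt{p_kq_k}}\,\mathbb E\Bigl[D_kF\bigl(D_kF+\sqrt{p_kq_k}\,(p_k-q_k)\bigr)\cdot\bigl|-D_kL^{-1}(F-\mathbb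 E[F])\bigr|\Bigr]. \end{aligned} $$ Here the inner product is almost surely an absolutely convergent series and defines an integrable random variable; the expectations in the last sum are those of nonnegative random variables, so that the last sum is well defined in $[0,\infty]$. -/

import Mathlib

open MeasureTheory ProbabilityTheory
open scoped ENNReal NNReal

noncomputable section

namespace Rademacher

/-- The sample space `{-1, +1}^ℕ`, with its product σ-algebra (`ℤˣ = {1, -1}`). -/
abbrev Config : Type := ℕ → ℤˣ

/-- The law `⨂ₖ (pₖ δ₊₁ + qₖ δ₋₁)` with `qₖ = 1 - pₖ` on the sample space. -/
abbrev law (p : ℕ → unitInterval) : Measure Config :=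
  Measure.infinitePi fun k => bernoulliMeasure (1 : ℤˣ) (-1) (p k)

/-- The coordinate `Xₖ`, as a real random variable with values `±1`. -/
def X (k : ℕ) (ω : Config) : ℝ := ((ω k : ℤ) : ℝ)

/-- `√(pₖ qₖ)`. -/
def sigma (p : ℕ → unitInterval) (k : ℕ) : ℝ := √((p k : ℝ) * (1 - (p k : ℝ)))

/-- The standardized coordinate `Yₖ = (Xₖ - pₖ + qₖ) / (2 √(pₖ qₖ))`. -/
def Y (p : ℕ → unitInterval) (k : ℕ) (ω : Config) : ℝ :=
  (X k ω - (p k : ℝ) + (1 - (p k : ℝ))) / (2 * sigma p k)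

lemma measurable_Y (p : ℕ → unitInterval) (k : ℕ) : Measurable (Y p k) := by
  have h : Measurable fun ω : Config => ((ω k : ℤ) : ℝ) :=
    (measurable_of_countable fun u : ℤ => (u : ℝ)).comp
      ((comap_measurable (Units.val : ℤˣ → ℤ)).comp (measurable_pi_apply k))
  unfold Y X
  fun_prop

lemma norm_Y_le (p : ℕ → unitInterval) (k : ℕ) (ω : Config) :
    ‖Y p k ω‖ ≤ max |(1 - (p k : ℝ) + (1 - (p k : ℝ))) / (2 * sigma p k)|
      |(-1 - (p k : ℝ) + (1 - (p k : ℝ))) / (2 * sigma p k)| := by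
  rcases Int.units_eq_one_or (ω k) with h | h 
  · exact (le_of_eq (by
      simp only [Y, X, h, Real.norm_eq_abs, Units.val_one, Int.cast_one])).trans (le_max_left _ _)
  · exact (le_of_eq (by
      simp only [Y, X, h, Real.norm_eq_abs, Units.val_one, Units.val_neg, Int.cast_one, Int.cast_neg])).trans (le_max_right _ _)

lemma memLp_prod_Y (p : ℕ → unitInterval) {n : ℕ} (i : Fin n → ℕ) :
    MemLp (fun ω => ∏ j, Y p (i j) ω) 2 (law p) := by
  refine MemLp.of_bound (Finset.measurable_prod _ fun j _ => measurable_Y p (i j)).aestronglyMeasurable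
    (∏ j, max |(1 - (p (i j) : ℝ) + (1 - (p (i j) : ℝ))) / (2 * sigma p (i j))|
      |(-1 - (p (i j) : ℝ) + (1 - (p (i j) : ℝ))) / (2 * sigma p (i j))|) ?_
  refine Filter.Eventually.of_forall fun ω => ?_
  rw [norm_prod]
  exact Finset.prod_le_prod (fun _ _ => norm_nonneg _) fun j _ => norm_Y_le p (i j) ω

/-- The product `Y_{i₁} ⋯ Y_{iₙ}` as an element of `L²(Ω)`. -/
def prodY (p : ℕ → unitInterval) {n : ℕ} (i : Fin n → ℕ) : Lp ℝ 2 (law p) :=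
  (memLp_prod_Y p i).toLp _

/-- Square-summable kernels on `ℕⁿ` that are symmetric and vanish on diagonals. -/
structure IsKernel {n : ℕ} (f : (Fin n → ℕ) → ℝ) : Prop where
  summable_sq : Summable fun i => f i ^ 2
  symm : ∀ (τ : Equiv.Perm (Fin n)) (i : Fin n → ℕ), f (i ∘ τ) = f i
  diag : ∀ i : Fin n → ℕ, ¬ Function.Injective i → f i = 0

/-- The discrete multiple stochastic integral
`Jₙ(f) = ∑_{i ∈ ℕⁿ} f(i) Y_{i₁} ⋯ Y_{iₙ}`, the sum being taken in `L²(Ω)`; in particular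
`J₀(c) = c`. -/
def J (p : ℕ → unitInterval) {n : ℕ} (f : (Fin n → ℕ) → ℝ) : Lp ℝ 2 (law p) :=
  ∑' i, f i • prodY p i

/-- `F = E[F] + ∑_{n ≥ 1} Jₙ(fₙ)` in `L²(Ω)`, where `F` is square integrable and the `fₙ` are
symmetric square-summable kernels vanishing on diagonals. The constant term is `J₀(f₀) = E[F]`. -/
def IsChaosRepresentation (p : ℕ → unitInterval) (F : Config → ℝ) (f : (n : ℕ) → (Fin n → ℕ) → ℝ) : Prop :=
  (∀ n, IsKernel (f n)) ∧ (f 0 = fun _ => ∫ ω, F ω ∂law p) ∧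
    ∃ hF : MemLp F 2 (law p), HasSum (fun n => J p (f n)) (hF.toLp F)

open Classical in
/-- The kernels of the (unique) chaos representation of a square-integrable `F`. -/
def chaosKernel (p : ℕ → unitInterval) (F : Config → ℝ) : (n : ℕ) → (Fin n → ℕ) → ℝ :=
  if h : ∃ f, IsChaosRepresentation p F f then h.choose else 0

/-- The pseudo-inverse of the Ornstein-Uhlenbeck operator, `L⁻¹ F = -∑_{n ≥ 1} (1/n) Jₙ(fₙ)`
for centered `F ∈ L²(Ω)` with chaos kernels `fₙ`. -/
def invL (p : ℕ → unitInterval) (F : Config → ℝ) : Lp ℝ 2 (law p) :=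
  -∑' n : ℕ, (1 / ((n : ℝ) + 1)) • J p (chaosKernel p F (n + 1))

/-- The discrete gradient `DₖF(ω) = √(pₖ qₖ) (F(ω₊ᵏ) - F(ω₋ᵏ))`. -/
def grad (p : ℕ → unitInterval) (k : ℕ) (F : Config → ℝ) (ω : Config) : ℝ :=
  sigma p k * (F (Function.update ω k 1) - F (Function.update ω k (-1)))

/-- `F ∈ dom(D)`: `F` is square integrable and `E[‖DF‖²_{ℓ²(ℕ)}] < ∞`. -/
def DomD (p : ℕ → unitInterval) (F : Config → ℝ) : Prop :=
  MemLp F 2 (law p) ∧ ∫⁻ ω, ∑' k, ENNReal.ofReal (grad p k F ω ^ 2) ∂law p < ∞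

/-- The process `-Dₖ L⁻¹(F - E[F])`. (The gradient of an almost surely defined random variable is
almost surely well defined, because every `pₖ` lies strictly between `0` and `1`.) -/
def negGradInvL (p : ℕ → unitInterval) (F : Config → ℝ) (k : ℕ) (ω : Config) : ℝ :=
  -grad p k (invL p fun ω' => F ω' - ∫ ω'', F ω'' ∂law p) ω

/-- The inner product `⟨DF, -DL⁻¹(F - E[F])⟩_{ℓ²(ℕ)}`. -/
def innerDL (p : ℕ → unitInterval) (F : Config → ℝ) (ω : Config) : ℝ :=
  ∑' k, grad p k F ω * negGradInvL p F k ω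

/-- The random variable `DₖF (DₖF + √(pₖ qₖ) (pₖ - qₖ)) |-DₖL⁻¹(F - E[F])|`. -/
def remainder (p : ℕ → unitInterval) (F : Config → ℝ) (k : ℕ) (ω : Config) : ℝ :=
  grad p k F ω * (grad p k F ω + sigma p k * ((p k : ℝ) - (1 - (p k : ℝ)))) *
    |negGradInvL p F k ω|

/-- The total variation distance `sup_{A ⊆ ℕ₀} |μ(A) - ν(A)|` between laws on `ℕ₀`. -/
def dTV (μ ν : Measure ℕ) : ℝ := ⨆ A : Set ℕ, |μ.real A - ν.real A|

end Rademacher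

end

/-!
The bound combines the Chen-Stein method for the Poisson law with integration by parts on the
Rademacher chaos.

*Stein equation.* For `A ⊆ ℕ` let `f` solve `λ f(j + 1) - j f(j) = 1_A(j) - Po(λ)(A)`, so that
`P(F ∈ A) - Po(λ)(A) = E[λ f(F + 1) - F f(F)]`. The solution is
`f(j + 1) = -∫₀¹ (E[1_A(Z_u + 1)] - E[1_A(Z_u)]) du` with `Z_u ∼ Bin(j, 1 - u) ∗ Po(λu)`
(`SteinPoisson.steinSol`), by the forward equation of the immigration-death process. Since the
Poisson weights are unimodal and at most `1 / √(2eμ)` for mean `μ` (`weight_le_inv_sqrt`), this gives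
`|f| ≤ min(1, √(2 / (eλ)))` (`abs_steinSol_le`). The increments satisfy
`|f(j + 1) - f(j)| ≤ (1 - e^{-λ}) / λ` (`abs_steinSol_succ_sub_le`), from the explicit form of `f` as a
quotient of partial sums.

*Covariance formula.* The Walsh functions `W_S = ∏_{i ∈ S} Yᵢ`, `S` finite, form a Hilbert basis of
`L²(Ω)` (`walshBasis`). The chaos of order `n` is spanned by the `W_S` with `|S| = n`, so `L⁻¹`
multiplies the coefficient at `S` by `-1 / |S|` (`inner_walshLp_invL`), and `Dₖ W_S` is `W_{S \ {k}}`
if `k ∈ S` and `0` otherwise (`walshCoef_grad`). As every `S` is counted `|S|` times in the sum over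
`k`, this yields `E[(F - E[F]) H] = E[⟨DH, -DL⁻¹(F - E[F])⟩]` (`integral_sub_mean_mul`).

*Chain rule.* For `H = f(F)`, `Dₖ f(F)` is replaced by `(f(F + 1) - f(F)) DₖF`. If `d` is the integer
jump of `F` in the `k`-th coordinate, the error is at most `√(pₖqₖ) ‖Δf‖` times `d(d + 1)` where
`ωₖ = 1` and `d(d - 1)` where `ωₖ = -1` (`abs_taylor_le`). Both `d` and `DₖL⁻¹(F - E[F])` do not
depend on `ωₖ`, and averaging over `ωₖ` produces `d(d + pₖ - qₖ)`, that is, the last term of the bound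
(`lintegral_chainError_le`).
-/

noncomputable section

namespace SteinPoisson

/-! ### The Poisson weights -/

/-- The weight `e^{-μ} μ^r / r!` of the Poisson law of mean `μ` (for an arbitrary real `μ`). -/
def weight (μ : ℝ) (r : ℕ) : ℝ := Real.exp (-μ) * μ ^ r / r.factorial

/-- The mean of `h` under the Poisson law of mean `μ`. -/
def mean (μ : ℝ) (h : ℕ → ℝ) : ℝ := ∑' r, weight μ r * h r

lemma hasSum_weight (μ : ℝ) : HasSum (weight μ) 1 := by
  have h := (NormedSpace.expSeries_div_hasSum_exp (𝔸 := ℝ) μ).mul_left (Real.exp (-μ))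
  rw [← Real.exp_eq_exp_ℝ, ← Real.exp_add, neg_add_cancel, Real.exp_zero] at h
  convert! h using 2 with r
  unfold weight
  ring

lemma weight_nonneg {μ : ℝ} (hμ : 0 ≤ μ) (r : ℕ) : 0 ≤ weight μ r := by
  unfold weight
  positivity

lemma weight_pos {μ : ℝ} (hμ : 0 < μ) (r : ℕ) : 0 < weight μ r := by
  unfold weight
  positivity

lemma weight_succ (μ : ℝ) (r : ℕ) : ((r : ℝ) + 1) * weight μ (r + 1) = μ * weight μ r := by
  unfold weight
  rw [Nat.factorial_succ]
  push_cast
  have : (r.factorial : ℝ) ≠ 0 := by positivity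
  field_simp
  ring

lemma weight_zero (μ : ℝ) : weight μ 0 = Real.exp (-μ) := by simp [weight]

lemma summable_weight_mul (μ : ℝ) {h : ℕ → ℝ} {C : ℝ} (hC : ∀ r, |h r| ≤ C) :
    Summable fun r => weight μ r * h r := by
  refine Summable.of_norm_bounded ((hasSum_weight μ).summable.abs.mul_right C) fun r => ?_
  rw [Real.norm_eq_abs, abs_mul]
  exact mul_le_mul_of_nonneg_left (hC r) (abs_nonneg _)

lemma mean_sub (μ : ℝ) {g h : ℕ → ℝ} {C D : ℝ} (hg : ∀ r, |g r| ≤ C) (hh : ∀ r, |h r| ≤ D) :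
    mean μ (fun r => g r - h r) = mean μ g - mean μ h := by
  unfold mean
  rw [← (summable_weight_mul μ hg).tsum_sub (summable_weight_mul μ hh)]
  exact tsum_congr fun r => by ring

lemma mean_zero (h : ℕ → ℝ) : mean 0 h = h 0 := by
  unfold mean
  rw [tsum_eq_single 0]
  · simp [weight]
  · intro r hr
    simp [weight, hr]

/-- Bounded power series: the derivative of `∑ μ^r / r! h(r)` shifts the coefficients. -/
lemma hasDerivAt_tsum_pow_div_factorial {h : ℕ → ℝ} {C : ℝ} (hC : ∀ r, |h r| ≤ C) (μ : ℝ) :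
    HasDerivAt (fun x : ℝ => ∑' r : ℕ, x ^ r / r.factorial * h r)
      (∑' r : ℕ, μ ^ r / r.factorial * h (r + 1)) μ := by
  set R := |μ| + 1 with hR
  have hR0 : 0 ≤ R := by positivity
  have hC0 : 0 ≤ C := (abs_nonneg _).trans (hC 0)
  have hsum : Summable fun r : ℕ => ((r : ℝ) * R ^ (r - 1) / r.factorial) * C := by
    refine Summable.mul_right C ?_
    rw [← summable_nat_add_iff 1]
    refine (Real.summable_pow_div_factorial R).congr fun r => ?_
    rw [Nat.factorial_succ]
    push_cast
    have : (r.factorial : ℝ) ≠ 0 := by positivity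
    field_simp
  have hd := hasDerivAt_tsum_of_isPreconnected (t := Metric.ball (0 : ℝ) R)
    (g := fun (r : ℕ) (x : ℝ) => x ^ r / r.factorial * h r)
    (g' := fun (r : ℕ) (x : ℝ) => (r : ℝ) * x ^ (r - 1) / r.factorial * h r) hsum
    Metric.isOpen_ball (convex_ball _ _).isPreconnected
    (fun r x _ => ((hasDerivAt_pow r x).div_const _).mul_const _)
    (fun r x hx => by
      have hx' : |x| ≤ R := by simpa [Real.dist_eq] using (Metric.mem_ball.1 hx).le
      rw [Real.norm_eq_abs, abs_mul, abs_div, abs_mul, abs_pow, Nat.abs_cast, Nat.abs_cast]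
      gcongr
      exact hC r)
    (y₀ := 0) (Metric.mem_ball_self (by positivity))
    (summable_of_ne_finset_zero (s := {0}) fun r hr => by
      have : r ≠ 0 := by simpa using hr
      simp [this])
    (y := μ) (by rw [Metric.mem_ball, Real.dist_eq, sub_zero]; linarith)
  refine hd.congr_deriv ?_
  rw [Summable.tsum_eq_zero_add (f := fun r : ℕ => (r : ℝ) * μ ^ (r - 1) / r.factorial * h r)]
  · simp only [Nat.cast_zero, zero_mul, zero_div, zero_add]
    refine tsum_congr fun r => ?_
    rw [Nat.factorial_succ]
    push_cast
    have : (r.factorial : ℝ) ≠ 0 := by positivity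
    field_simp
  · refine Summable.of_norm_bounded hsum fun r => ?_
    rw [Real.norm_eq_abs, abs_mul, abs_div, abs_mul, abs_pow, Nat.abs_cast, Nat.abs_cast]
    have : |μ| ≤ R := by linarith
    gcongr
    exact hC r

/-- The forward equation of the Poisson semigroup. -/
lemma hasDerivAt_mean {h : ℕ → ℝ} {C : ℝ} (hC : ∀ r, |h r| ≤ C) (μ : ℝ) :
    HasDerivAt (fun x => mean x h) (mean μ fun r => h (r + 1) - h r) μ := by
  have hE : ∀ (g : ℕ → ℝ) (x : ℝ),
      mean x g = Real.exp (-x) * ∑' r : ℕ, x ^ r / r.factorial * g r := fun g x => by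
    unfold mean weight
    rw [← tsum_mul_left]
    exact tsum_congr fun r => by ring
  rw [mean_sub μ (fun r => hC (r + 1)) hC]
  have h1 := ((hasDerivAt_neg μ).exp).mul (hasDerivAt_tsum_pow_div_factorial hC μ)
  rw [show (fun x => mean x h) = fun x => Real.exp (-x) * ∑' r : ℕ, x ^ r / r.factorial * h r from
    funext fun x => hE h x]
  refine h1.congr_deriv ?_
  rw [hE, hE]
  ring

/-- Poisson weights increase up to the integer part of the mean and decrease afterwards, so
`E[h(N + 1)] - E[h(N)]` is at most the largest weight. -/
lemma neg_le_mean_diff {μ M : ℝ} (hμ : 0 ≤ μ) (hM : ∀ r, weight μ r ≤ M) {h : ℕ → ℝ}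
    (h0 : ∀ r, 0 ≤ h r) (h1 : ∀ r, h r ≤ 1) : -M ≤ mean μ fun r => h (r + 1) - h r := by
  have hb : ∀ r, |h r| ≤ 1 := fun r => abs_le.2 ⟨by linarith [h0 r], h1 r⟩
  rw [mean_sub μ (fun r => hb (r + 1)) hb]
  have hs := summable_weight_mul μ hb
  have hs' := summable_weight_mul μ fun r => hb (r + 1)
  have e : mean μ h = weight μ 0 * h 0 + ∑' r, weight μ (r + 1) * h (r + 1) :=
    hs.tsum_eq_zero_add
  rw [e]
  have hs2 : Summable fun r => weight μ (r + 1) * h (r + 1) := (summable_nat_add_iff 1).2 hs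
  have e2 : mean μ (fun r => h (r + 1)) - ∑' r, weight μ (r + 1) * h (r + 1)
      = ∑' r, (weight μ r * h (r + 1) - weight μ (r + 1) * h (r + 1)) := (hs'.tsum_sub hs2).symm
  set m := ⌊μ⌋₊ with hm
  have hstep : ∀ r : ℕ, (r + 1 : ℝ) * (weight μ r - weight μ (r + 1)) = (r + 1 - μ) * weight μ r :=
    fun r => by linear_combination - weight_succ μ r
  have hlow : ∑ r ∈ Finset.range m, (weight μ r - weight μ (r + 1)) ≤
      ∑' r, (weight μ r * h (r + 1) - weight μ (r + 1) * h (r + 1)) := by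
    have hfin : ∑ r ∈ Finset.range m, (weight μ r - weight μ (r + 1)) =
        ∑' r, if r < m then weight μ r - weight μ (r + 1) else 0 := by
      rw [tsum_eq_sum (s := Finset.range m) fun r hr => by simp at hr; simp [hr]]
      exact Finset.sum_congr rfl fun r hr => (if_pos (Finset.mem_range.1 hr)).symm
    rw [hfin]
    refine Summable.tsum_le_tsum (fun r => ?_) ?_ (hs'.sub hs2)
    · rw [← sub_mul]
      have hr1 : (0 : ℝ) < r + 1 := by positivity
      have hw := weight_nonneg hμ r
      split_ifs with hr
      · have : (r + 1 : ℝ) ≤ μ := by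
          have := (Nat.le_floor_iff hμ).1 (Nat.succ_le_of_lt hr)
          exact_mod_cast this
        have hneg : weight μ r - weight μ (r + 1) ≤ 0 := by
          by_contra hc
          push Not at hc
          have := mul_pos hr1 hc
          rw [hstep] at this
          nlinarith
        nlinarith [h1 (r + 1)]
      · have : μ ≤ r + 1 := by
          have := Nat.lt_of_floor_lt (Nat.lt_succ_of_le (not_lt.1 hr))
          push_cast at this
          exact this.le
        have hpos : 0 ≤ weight μ r - weight μ (r + 1) := by
          by_contra hc
          push Not at hc
          have := mul_neg_of_pos_of_neg hr1 hc
          rw [hstep] at this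
          nlinarith
        exact mul_nonneg hpos (h0 _)
    · exact summable_of_ne_finset_zero (s := Finset.range m) fun r hr => by
        simp at hr; simp [hr]
  rw [Finset.sum_range_sub'] at hlow
  have hw0 := weight_nonneg hμ 0
  have := hM m
  have := mul_le_of_le_one_right hw0 (h1 0)
  linarith

lemma abs_mean_diff_le {μ M : ℝ} (hμ : 0 ≤ μ) (hM : ∀ r, weight μ r ≤ M) {h : ℕ → ℝ}
    (h0 : ∀ r, 0 ≤ h r) (h1 : ∀ r, h r ≤ 1) : |mean μ fun r => h (r + 1) - h r| ≤ M := by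
  refine abs_le.2 ⟨neg_le_mean_diff hμ hM h0 h1, ?_⟩
  have := neg_le_mean_diff hμ hM (h := fun r => 1 - h r) (fun r => by linarith [h1 r])
    (fun r => by linarith [h0 r])
  have e : (mean μ fun r => (1 - h (r + 1)) - (1 - h r)) = - mean μ fun r => h (r + 1) - h r := by
    unfold mean
    rw [← tsum_neg]
    exact tsum_congr fun r => by ring
  rw [e] at this
  linarith

/-! ### The largest Poisson weight -/

/-- The derivative of the difference of both sides is `log (1 - y²) ≤ 0`. -/
lemma log_one_add_sub_log_one_sub_le {y : ℝ} (hy0 : 0 ≤ y) (hy1 : y < 1) :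
    (1 + y) * Real.log (1 + y) - (1 - y) * Real.log (1 - y) ≤ 2 * y := by
  have hanti : AntitoneOn (fun x : ℝ => (1 + x) * Real.log (1 + x) - (1 - x) * Real.log (1 - x)
      - 2 * x) (Set.Ico 0 1) := by
    have hd : ∀ x ∈ Set.Ico (0 : ℝ) 1, HasDerivAt
        (fun x : ℝ => (1 + x) * Real.log (1 + x) - (1 - x) * Real.log (1 - x) - 2 * x)
        (Real.log (1 + x) + Real.log (1 - x)) x := by
      intro x hx
      have h1 : (1 + x) ≠ 0 := by linarith [hx.1]
      have h2 : (1 - x) ≠ 0 := by linarith [hx.2]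
      have a := (hasDerivAt_id x).const_add 1
      have b := (hasDerivAt_id x).const_sub 1
      refine (((a.mul (a.log h1)).sub (b.mul (b.log h2))).sub
        ((hasDerivAt_id x).const_mul 2)).congr_deriv ?_
      simp only [id]
      field_simp
      ring
    refine antitoneOn_of_deriv_nonpos (convex_Ico 0 1)
      (fun x hx => (hd x hx).continuousAt.continuousWithinAt)
      (fun x hx => (hd x (interior_subset hx)).differentiableAt.differentiableWithinAt)
      fun x hx => ?_
    have hx' := interior_subset hx
    rw [(hd x hx').deriv, ← Real.log_mul (by linarith [hx'.1]) (by linarith [hx'.2])]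
    refine Real.log_nonpos ?_ ?_ <;> nlinarith [hx'.1, hx'.2]
  have := hanti (Set.left_mem_Ico.2 one_pos) ⟨hy0, hy1⟩ hy0
  norm_num at this
  linarith

/-- `μ ↦ e^{-μ} μ^{r + 1/2} / r!` is largest at `μ = r + 1/2`, and the logarithm of its maximum
decreases in `r`; at `r = 0` it is `-(log 2 + 1) / 2`. -/
lemma half_add_mul_log_sub_le (r : ℕ) :
    ((r : ℝ) + 1 / 2) * Real.log (r + 1 / 2) - (r + 1 / 2) - Real.log r.factorial
      ≤ - (Real.log 2 + 1) / 2 := by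
  induction r with
  | zero =>
    simp only [Nat.cast_zero, zero_add, Nat.factorial_zero, Nat.cast_one, Real.log_one, one_div,
      Real.log_inv]
    linarith
  | succ r ih =>
    refine le_trans ?_ ih
    rw [Nat.factorial_succ]
    push_cast
    have hx : (0 : ℝ) < r + 1 := by positivity
    have hf : (r.factorial : ℝ) ≠ 0 := by positivity
    rw [Real.log_mul hx.ne' hf]
    set x : ℝ := r + 1 with hxd
    have hr : (0 : ℝ) ≤ r := by positivity
    have hx1 : 1 ≤ x := by linarith
    set y : ℝ := 1 / (2 * x) with hyd
    have hxy : x * y = 1 / 2 := by rw [hyd]; field_simp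
    have hy0 : 0 < y := by rw [hyd]; positivity
    have hy1 : y < 1 := by nlinarith
    have key := log_one_add_sub_log_one_sub_le hy0.le hy1
    have e1 : x + 1 / 2 = x * (1 + y) := by linear_combination - hxy
    have e2 : (r : ℝ) + 1 / 2 = x * (1 - y) := by linear_combination hxy
    rw [e2, e1, Real.log_mul hx.ne' (by linarith), Real.log_mul hx.ne' (by linarith)]
    have h3 : x * ((1 + y) * Real.log (1 + y) - (1 - y) * Real.log (1 - y)) ≤ 1 := by
      calc _ ≤ x * (2 * y) := mul_le_mul_of_nonneg_left key hx.le
        _ = 1 := by linear_combination 2 * hxy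
    have h4 : x * y * Real.log x = 1 / 2 * Real.log x := by rw [hxy]
    nlinarith

lemma weight_le_one {μ : ℝ} (hμ : 0 ≤ μ) (r : ℕ) : weight μ r ≤ 1 :=
  le_hasSum (hasSum_weight μ) r fun _ _ => weight_nonneg hμ _

/-- The largest weight of a Poisson law of mean `μ` is at most `1 / √(2eμ)`. -/
lemma weight_le_inv_sqrt {μ : ℝ} (hμ : 0 < μ) (r : ℕ) :
    weight μ r ≤ 1 / √(2 * Real.exp 1 * μ) := by
  have hw := weight_pos hμ r
  have hs : 0 < 2 * Real.exp 1 * μ := by positivity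
  rw [le_div_iff₀ (Real.sqrt_pos.2 hs)]
  rw [← Real.log_nonpos_iff (by positivity), Real.log_mul hw.ne' (by positivity),
    Real.log_sqrt hs.le, Real.log_mul (by positivity) hμ.ne',
    Real.log_mul (by positivity) (by positivity), Real.log_exp]
  unfold weight
  rw [Real.log_div (by positivity) (by positivity), Real.log_mul (by positivity) (by positivity),
    Real.log_exp, Real.log_pow]
  have h := half_add_mul_log_sub_le r
  set c : ℝ := r + 1 / 2 with hc
  have hc0 : 0 < c := by positivity
  have hl := Real.log_le_sub_one_of_pos (div_pos hμ hc0)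
  rw [Real.log_div hμ.ne' hc0.ne'] at hl
  have h5 : c * (Real.log μ - Real.log c) ≤ μ - c := by
    calc _ ≤ c * (μ / c - 1) := mul_le_mul_of_nonneg_left hl hc0.le
      _ = μ - c := by field_simp
  have e : (r : ℝ) = c - 1 / 2 := by rw [hc]; ring
  rw [e]
  nlinarith

/-! ### The immigration-death semigroup and the Stein equation -/

/-- `E[h(B + N)]` for independent `B ∼ Bin(j, 1 - u)` and `N ∼ Po(lam u)`: the semigroup, started at
`j`, of the immigration-death process with stationary law `Po(lam)`, where `1 - u = e^{-t}` for the
time `t`. The recursion conditions on one of the `j` Bernoulli variables. -/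
def mixMean (lam u : ℝ) : ℕ → (ℕ → ℝ) → ℝ
  | 0, h => mean (lam * u) h
  | j + 1, h => (1 - u) * mixMean lam u j (fun r => h (r + 1)) + u * mixMean lam u j h

lemma mixMean_sub (lam u : ℝ) (j : ℕ) {g h : ℕ → ℝ} {C D : ℝ} (hg : ∀ r, |g r| ≤ C)
    (hh : ∀ r, |h r| ≤ D) :
    mixMean lam u j (fun r => g r - h r) = mixMean lam u j g - mixMean lam u j h := by
  induction j generalizing g h with
  | zero => exact mean_sub _ hg hh
  | succ j ih =>
    simp only [mixMean]
    rw [ih (fun r => hg (r + 1)) fun r => hh (r + 1), ih hg hh]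
    ring

lemma mixMean_at_zero (lam : ℝ) (j : ℕ) (h : ℕ → ℝ) : mixMean lam 0 j h = h j := by
  induction j generalizing h with
  | zero => rw [mixMean, mul_zero, mean_zero]
  | succ j ih => rw [mixMean, ih, ih]; ring

lemma mixMean_at_one (lam : ℝ) (j : ℕ) (h : ℕ → ℝ) : mixMean lam 1 j h = mean lam h := by
  induction j generalizing h with
  | zero => rw [mixMean, mul_one]
  | succ j ih => rw [mixMean, ih, ih]; ring

/-- The forward equation of the immigration-death semigroup. -/
lemma hasDerivAt_mixMean (lam u : ℝ) (j : ℕ) {h : ℕ → ℝ} {C : ℝ} (hC : ∀ r, |h r| ≤ C) :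
    HasDerivAt (fun v => mixMean lam v j h) (lam * mixMean lam u j (fun r => h (r + 1) - h r)
      - j * mixMean lam u (j - 1) fun r => h (r + 1) - h r) u := by
  induction j generalizing h with
  | zero =>
    simp only [mixMean, Nat.cast_zero, zero_mul, sub_zero]
    have := (hasDerivAt_mean hC (lam * u)).comp u ((hasDerivAt_id u).const_mul lam)
    refine this.congr_deriv ?_
    ring
  | succ j ih =>
    have h1 := ((hasDerivAt_id u).const_sub 1).mul (ih (h := fun r => h (r + 1))
      fun r => hC (r + 1))
    have h2 := (hasDerivAt_id u).mul (ih hC)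
    have h3 := h1.add h2
    refine h3.congr_deriv ?_
    simp only [id, Nat.add_sub_cancel, Nat.cast_add, Nat.cast_one]
    rw [mixMean_sub lam u j (fun r => hC (r + 1)) hC]
    rcases j with _ | j
    · simp only [mixMean]
      rw [mean_sub _ (fun r => hC (r + 1)) hC, mean_sub _ (fun r => hC (r + 1 + 1))
        (fun r => hC (r + 1))]
      push_cast
      ring
    · simp only [Nat.add_sub_cancel]
      simp only [mixMean]
      rw [mixMean_sub _ _ _ (fun r => hC (r + 1)) hC, mixMean_sub _ _ _ (fun r => hC (r + 1 + 1))
        (fun r => hC (r + 1)), mixMean_sub _ _ _ (fun r => hC (r + 1 + 1 + 1))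
        (fun r => hC (r + 1 + 1))]
      push_cast
      ring

lemma abs_mixMean_diff_le {lam u M : ℝ} (hlam : 0 ≤ lam) (hu : u ∈ Set.Icc (0 : ℝ) 1)
    (hM : ∀ r, weight (lam * u) r ≤ M) (j : ℕ) {h : ℕ → ℝ}
    (h0 : ∀ r, 0 ≤ h r) (h1 : ∀ r, h r ≤ 1) :
    |mixMean lam u j fun r => h (r + 1) - h r| ≤ M := by
  induction j generalizing h with
  | zero => exact abs_mean_diff_le (mul_nonneg hlam hu.1) hM h0 h1
  | succ j ih =>
    have a := abs_le.1 (ih (h := fun r => h (r + 1)) (fun r => h0 (r + 1)) fun r => h1 (r + 1))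
    have b := abs_le.1 (ih h0 h1)
    rw [mixMean]
    refine abs_le.2 ⟨?_, ?_⟩
    · nlinarith [mul_le_mul_of_nonneg_left a.1 (sub_nonneg.2 hu.2),
        mul_le_mul_of_nonneg_left b.1 hu.1]
    · nlinarith [mul_le_mul_of_nonneg_left a.2 (sub_nonneg.2 hu.2),
        mul_le_mul_of_nonneg_left b.2 hu.1]

/-- The solution of the Stein equation of `Po(lam)` with right-hand side `h`, normalized by
`steinSol lam h 0 = steinSol lam h 1`. The value at `0` does not enter the Stein equation; with this
choice it does not affect the bounds either. -/
def steinSol (lam : ℝ) (h : ℕ → ℝ) (j : ℕ) : ℝ :=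
  -∫ u in (0 : ℝ)..1, mixMean lam u (j - 1) fun r => h (r + 1) - h r

lemma continuous_mixMean (lam : ℝ) (j : ℕ) {h : ℕ → ℝ} {C : ℝ} (hC : ∀ r, |h r| ≤ C) :
    Continuous fun u => mixMean lam u j h :=
  continuous_iff_continuousAt.2 fun u => (hasDerivAt_mixMean lam u j hC).continuousAt

lemma abs_diff_le_two {h : ℕ → ℝ} {C : ℝ} (hC : ∀ r, |h r| ≤ C) (r : ℕ) :
    |h (r + 1) - h r| ≤ 2 * C := by
  have a := abs_le.1 (hC (r + 1))
  have b := abs_le.1 (hC r)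
  exact abs_le.2 ⟨by linarith, by linarith⟩

/-- The Stein equation. -/
lemma steinSol_equation (lam : ℝ) {h : ℕ → ℝ} {C : ℝ} (hC : ∀ r, |h r| ≤ C) (j : ℕ) :
    lam * steinSol lam h (j + 1) - j * steinSol lam h j = h j - mean lam h := by
  have hc : ∀ i, Continuous fun u => mixMean lam u i fun r => h (r + 1) - h r := fun i =>
    continuous_mixMean lam i (abs_diff_le_two hC)
  have h1 := intervalIntegral.integral_eq_sub_of_hasDerivAt (a := 0) (b := 1)
    (fun u _ => hasDerivAt_mixMean lam u j hC)
    (((continuous_const.mul (hc j)).sub (continuous_const.mul (hc (j - 1)))).intervalIntegrable 0 1)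
  rw [intervalIntegral.integral_sub (((hc j).intervalIntegrable 0 1).const_mul lam)
    (((hc (j - 1)).intervalIntegrable 0 1).const_mul (j : ℝ)),
    intervalIntegral.integral_const_mul, intervalIntegral.integral_const_mul, mixMean_at_one,
    mixMean_at_zero] at h1
  unfold steinSol
  rw [Nat.add_sub_cancel]
  linarith

/-- The sup-norm bound: `|E[h(Z + 1)] - E[h(Z)]|` is at most the largest weight of `Po(lam u)`, and
`∫₀¹ du / √(2 e lam u) = √(2 / (e lam))`. -/
lemma abs_steinSol_le {lam : ℝ} (hlam : 0 < lam) {h : ℕ → ℝ} (h0 : ∀ r, 0 ≤ h r)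
    (h1 : ∀ r, h r ≤ 1) (j : ℕ) :
    |steinSol lam h j| ≤ min 1 √(2 / (Real.exp 1 * lam)) := by
  unfold steinSol
  rw [abs_neg]
  refine le_min ?_ ?_
  · have := intervalIntegral.norm_integral_le_of_norm_le_const (a := 0) (b := 1) (C := 1)
      (f := fun u => mixMean lam u (j - 1) fun r => h (r + 1) - h r) fun u hu => by
        rw [Set.uIoc_of_le zero_le_one] at hu
        exact abs_mixMean_diff_le hlam.le ⟨hu.1.le, hu.2⟩
          (weight_le_one (mul_nonneg hlam.le hu.1.le)) _ h0 h1
    simpa using this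
  · set c : ℝ := 1 / √(2 * Real.exp 1 * lam) with hc
    have hint : ∫ u in (0 : ℝ)..1, c * u ^ (-(1 / 2) : ℝ) = √(2 / (Real.exp 1 * lam)) := by
      rw [intervalIntegral.integral_const_mul, integral_rpow (Or.inl (by norm_num))]
      have e : √(2 / (Real.exp 1 * lam)) = 2 / √(2 * Real.exp 1 * lam) := by
        rw [show 2 / (Real.exp 1 * lam) = 2 ^ 2 / (2 * Real.exp 1 * lam) by field_simp,
          Real.sqrt_div (by norm_num), Real.sqrt_sq (by norm_num)]
      rw [e, hc]
      norm_num
      ring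
    rw [← hint, ← Real.norm_eq_abs]
    refine intervalIntegral.norm_integral_le_of_norm_le zero_le_one
      (Filter.Eventually.of_forall fun u hu => ?_)
      ((intervalIntegral.intervalIntegrable_rpow' (r := -(1 / 2)) (by norm_num)).const_mul c)
    refine abs_mixMean_diff_le hlam.le ⟨hu.1.le, hu.2⟩ (fun r => ?_) _ h0 h1
    refine (weight_le_inv_sqrt (mul_pos hlam hu.1) r).trans_eq ?_
    rw [hc, ← mul_assoc, Real.sqrt_mul (by positivity) u, Real.rpow_neg hu.1.le,
      ← Real.sqrt_eq_rpow]
    field_simp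

/-! ### The increments of the Stein solution -/

/-- The explicit form of the Stein solution as a quotient of partial sums. -/
lemma weight_mul_steinSol (lam : ℝ) {h : ℕ → ℝ} {C : ℝ} (hC : ∀ r, |h r| ≤ C) (k : ℕ) :
    lam * weight lam k * steinSol lam h (k + 1) =
      ∑ r ∈ Finset.range (k + 1), weight lam r * (h r - mean lam h) := by
  induction k with
  | zero =>
    have := steinSol_equation lam hC 0
    simp only [Nat.cast_zero, zero_mul, sub_zero] at this
    simp only [zero_add, Finset.sum_range_one]
    rw [← this]
    ring
  | succ k ih =>
    rw [Finset.sum_range_succ, ← ih, ← steinSol_equation lam hC (k + 1)]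
    have := weight_succ lam k
    push_cast
    linear_combination steinSol lam h (k + 1) * this

/-- The increment bound: with `U_k`, `T_k` the masses of `[0, k]` and `(k, ∞)`, the monotonicity of
`U_k / weight k` and `T_k / weight k` leaves only the atom at `k + 1` with a positive contribution. -/
lemma steinSol_diff_le {lam : ℝ} (hlam : 0 < lam) {h : ℕ → ℝ} (h0 : ∀ r, 0 ≤ h r)
    (h1 : ∀ r, h r ≤ 1) (k : ℕ) :
    |steinSol lam h (k + 2) - steinSol lam h (k + 1)| ≤ (1 - Real.exp (-lam)) / lam := by
  have hb : ∀ r, |h r| ≤ 1 := fun r => abs_le.2 ⟨by linarith [h0 r], h1 r⟩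
  have hw := fun r => weight_pos hlam r
  have hsw := (hasSum_weight lam).summable
  have hsh := summable_weight_mul lam hb
  -- masses and partial means below and above `k + 1`
  set U := ∑ r ∈ Finset.range (k + 1), weight lam r with hU
  set A := ∑ r ∈ Finset.range (k + 1), weight lam r * h r with hA
  set T := ∑' r, weight lam (r + (k + 2)) with hT
  set B := ∑' r, weight lam (r + (k + 2)) * h (r + (k + 2)) with hB
  set w := weight lam (k + 1) with hwd
  set x := h (k + 1) with hx
  have hsT : Summable fun r => weight lam (r + (k + 2)) := (summable_nat_add_iff (k + 2)).2 hsw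
  have hsB : Summable fun r => weight lam (r + (k + 2)) * h (r + (k + 2)) :=
    (summable_nat_add_iff (k + 2)).2 hsh
  have hone : U + w + T = 1 := by
    rw [← (hasSum_weight lam).tsum_eq, ← hsw.sum_add_tsum_nat_add (k + 2), Finset.sum_range_succ]
  have hmean : mean lam h = A + w * x + B := by
    unfold mean
    rw [← hsh.sum_add_tsum_nat_add (k + 2), Finset.sum_range_succ]
  have hS1 : lam * weight lam k * steinSol lam h (k + 1) = A - mean lam h * U := by
    rw [weight_mul_steinSol lam hb, hA, hU, Finset.mul_sum, ← Finset.sum_sub_distrib]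
    exact Finset.sum_congr rfl fun r _ => by ring
  have hS2 : lam * w * steinSol lam h (k + 2) = A + w * x - mean lam h * (U + w) := by
    rw [weight_mul_steinSol lam hb (k + 1), Finset.sum_range_succ,
      ← weight_mul_steinSol lam hb k, hS1]
    ring
  have hA0 : 0 ≤ A := Finset.sum_nonneg fun r _ => mul_nonneg (hw r).le (h0 r)
  have hAU : A ≤ U := Finset.sum_le_sum fun r _ => mul_le_of_le_one_right (hw r).le (h1 r)
  have hB0 : 0 ≤ B := tsum_nonneg fun r => mul_nonneg (hw _).le (h0 _)
  have hBT : B ≤ T := hsB.tsum_le_tsum (fun r => mul_le_of_le_one_right (hw _).le (h1 _)) hsT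
  have hk : (0 : ℝ) < k + 1 := by positivity
  -- `lam U_k ≤ (k + 1) (U_{k + 1} - weight 0)`, as `lam * weight r = (r + 1) * weight (r + 1)`
  have hUle : lam * U ≤ (k + 1) * (U + w - Real.exp (-lam)) := by
    have e : U + w - Real.exp (-lam) = ∑ r ∈ Finset.range (k + 1), weight lam (r + 1) := by
      have := Finset.sum_range_succ' (fun r => weight lam r) (k + 1)
      rw [Finset.sum_range_succ] at this
      rw [← weight_zero]
      linarith
    rw [e, hU, Finset.mul_sum, Finset.mul_sum]
    refine Finset.sum_le_sum fun r hr => ?_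
    rw [← weight_succ]
    have : (r : ℝ) ≤ k := by exact_mod_cast Nat.lt_succ_iff.1 (Finset.mem_range.1 hr)
    exact mul_le_mul_of_nonneg_right (by linarith) (hw _).le
  -- `(k + 1) T_{k + 1} ≤ lam T_k`
  have hTle : (k + 1) * T ≤ lam * (T + w) := by
    have e : T + w = ∑' r, weight lam (r + (k + 1)) := by
      rw [((summable_nat_add_iff (k + 1)).2 hsw).tsum_eq_zero_add, zero_add, add_comm]
      congr 1
      exact tsum_congr fun r => by congr 1; ring
    rw [e, ← tsum_mul_left, ← tsum_mul_left]
    refine Summable.tsum_le_tsum (fun r => ?_) (hsT.mul_left _)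
      (((summable_nat_add_iff (k + 1)).2 hsw).mul_left _)
    rw [← weight_succ, show r + (k + 2) = r + (k + 1) + 1 by ring]
    push_cast
    have : (0 : ℝ) ≤ r := by positivity
    exact mul_le_mul_of_nonneg_right (by linarith) (hw _).le
  have hwk : (k + 1) * w = lam * weight lam k := weight_succ lam k
  -- the terms with `A` and `B` have nonpositive factors, by `hTle` and `hUle`
  have hkey : lam * w * (k + 1) * (steinSol lam h (k + 2) - steinSol lam h (k + 1)) =
      A * ((k + 1) * T - lam * (T + w)) - B * ((k + 1) * (U + w) - lam * U)
        + w * x * ((k + 1) * T + lam * U) := by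
    have e1 : lam * w * (k + 1) * steinSol lam h (k + 1) = lam * (A - mean lam h * U) := by
      rw [← hS1]
      linear_combination lam * steinSol lam h (k + 1) * hwk
    have e2 : lam * w * (k + 1) * steinSol lam h (k + 2) =
        (k + 1) * (A + w * x - mean lam h * (U + w)) := by
      rw [← hS2]; ring
    rw [mul_sub, e1, e2, hmean]
    have eT : T = 1 - U - w := by linarith
    rw [eT]
    ring
  have hexp : 0 ≤ Real.exp (-lam) := (Real.exp_pos _).le
  have hU0 : 0 ≤ U := hA0.trans hAU
  have hT0 : 0 ≤ T := hB0.trans hBT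
  have hw0 : 0 < w := hw _
  have hx0 : 0 ≤ x := h0 _
  have hx1 : x ≤ 1 := h1 _
  have hpos : 0 < lam * w * (k + 1) := by positivity
  have hmain : (k + 1) * T + lam * U ≤ (k + 1) * (1 - Real.exp (-lam)) := by
    linear_combination hUle + (k + 1) * hone
  have hq0 : 0 ≤ (k + 1) * T + lam * U := by positivity
  have hq : w * ((k + 1) * T + lam * U) ≤ lam * w * (k + 1) * ((1 - Real.exp (-lam)) / lam) := by
    calc _ ≤ w * ((k + 1) * (1 - Real.exp (-lam))) := mul_le_mul_of_nonneg_left hmain hw0.le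
      _ = _ := by field_simp
  have hP : 0 ≤ (k + 1) * (U + w) - lam * U := by
    linarith [mul_nonneg hk.le hexp, hUle, mul_sub ((k : ℝ) + 1) (U + w) (Real.exp (-lam))]
  have hN : 0 ≤ lam * (T + w) - (k + 1) * T := by linarith
  have hwx : w * x * ((k + 1) * T + lam * U) ≤ w * ((k + 1) * T + lam * U) :=
    mul_le_mul_of_nonneg_right (mul_le_of_le_one_right hw0.le hx1) hq0
  have hwx0 : 0 ≤ w * x * ((k + 1) * T + lam * U) := by positivity
  have hAN := mul_nonneg hA0 hN
  have hBP := mul_nonneg hB0 hP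
  have hAN' := mul_le_mul_of_nonneg_right hAU hN
  have hBP' := mul_le_mul_of_nonneg_right hBT hP
  have e : U * (lam * (T + w) - (k + 1) * T) + T * ((k + 1) * (U + w) - lam * U) =
      w * ((k + 1) * T + lam * U) := by ring
  have hkey' : lam * w * (k + 1) * (steinSol lam h (k + 2) - steinSol lam h (k + 1)) =
      -(A * (lam * (T + w) - (k + 1) * T)) - B * ((k + 1) * (U + w) - lam * U)
        + w * x * ((k + 1) * T + lam * U) := by rw [hkey]; ring
  clear_value U A T B w x
  refine abs_le.2 ⟨?_, ?_⟩
  · refine le_of_mul_le_mul_left (a := lam * w * (k + 1)) ?_ hpos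
    rw [hkey', mul_neg]
    linarith only [e, hAN', hBP', hwx0, hq]
  · refine le_of_mul_le_mul_left (a := lam * w * (k + 1)) ?_ hpos
    rw [hkey']
    linarith only [hAN, hBP, hwx, hq]

lemma abs_steinSol_succ_sub_le {lam : ℝ} (hlam : 0 < lam) {h : ℕ → ℝ} (h0 : ∀ r, 0 ≤ h r)
    (h1 : ∀ r, h r ≤ 1) (j : ℕ) :
    |steinSol lam h (j + 1) - steinSol lam h j| ≤ (1 - Real.exp (-lam)) / lam := by
  rcases j with _ | j
  · have : steinSol lam h (0 + 1) - steinSol lam h 0 = 0 := sub_self _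
    rw [this, abs_zero]
    have : Real.exp (-lam) ≤ 1 := Real.exp_le_one_iff.2 (by linarith)
    exact div_nonneg (by linarith) hlam.le
  · exact steinSol_diff_le hlam h0 h1 j

end SteinPoisson

namespace Rademacher

variable {p : ℕ → unitInterval}

/-! ### Resampling a coordinate -/

instance discreteMeasurableSpace_units_int : DiscreteMeasurableSpace ℤˣ where
  forall_measurableSet s :=
    ⟨Units.val '' s, .of_discrete, Set.preimage_image_eq s Units.val_injective⟩

lemma sigma_pos (hp : ∀ k, 0 < (p k : ℝ) ∧ (p k : ℝ) < 1) (k : ℕ) : 0 < sigma p k :=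
  Real.sqrt_pos.2 (mul_pos (hp k).1 (by linarith [(hp k).2]))

lemma sigma_sq (p : ℕ → unitInterval) (k : ℕ) : sigma p k ^ 2 = (p k : ℝ) * (1 - (p k : ℝ)) :=
  Real.sq_sqrt (mul_nonneg (p k).2.1 (by linarith [(p k).2.2]))

lemma Y_of_eq_one (p : ℕ → unitInterval) {k : ℕ} {ω : Config} (h : ω k = 1) :
    Y p k ω = (1 - (p k : ℝ)) / sigma p k := by
  simp only [Y, X, h, Units.val_one, Int.cast_one]
  rw [show (1 : ℝ) - p k + (1 - p k) = 2 * (1 - p k) by ring, mul_div_mul_left _ _ two_ne_zero]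

lemma Y_of_eq_neg_one (p : ℕ → unitInterval) {k : ℕ} {ω : Config} (h : ω k = -1) :
    Y p k ω = -(p k : ℝ) / sigma p k := by
  simp only [Y, X, h, Units.val_neg, Units.val_one, Int.cast_neg, Int.cast_one]
  rw [show (-1 : ℝ) - p k + (1 - p k) = 2 * (-p k) by ring, mul_div_mul_left _ _ two_ne_zero]

lemma Y_update_one (p : ℕ → unitInterval) (k : ℕ) (ω : Config) :
    Y p k (Function.update ω k 1) = (1 - (p k : ℝ)) / sigma p k :=
  Y_of_eq_one p (Function.update_self k _ ω)

lemma Y_update_neg_one (p : ℕ → unitInterval) (k : ℕ) (ω : Config) :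
    Y p k (Function.update ω k (-1)) = -(p k : ℝ) / sigma p k :=
  Y_of_eq_neg_one p (Function.update_self k _ ω)

lemma Y_update_of_ne (p : ℕ → unitInterval) {k i : ℕ} (h : i ≠ k) (a : ℤˣ) (ω : Config) :
    Y p i (Function.update ω k a) = Y p i ω := by
  simp [Y, X, Function.update_of_ne h]

lemma measurable_update_coord (k : ℕ) (a : ℤˣ) :
    Measurable fun ω : Config => Function.update ω k a :=
  measurable_pi_lambda _ fun i => by
    by_cases h : i = k
    · subst h; simp
    · simpa [Function.update_of_ne h] using measurable_pi_apply i

lemma law_map_update_pi (p : ℕ → unitInterval) (k : ℕ) (a : ℤˣ) (s : Finset ℕ)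
    (t : ℕ → Set ℤˣ) (hk : k ∈ s) :
    (law p).map (fun ω => Function.update ω k a) (Set.pi s t) =
      (t k).indicator 1 a * ∏ i ∈ s.erase k, bernoulliMeasure (1 : ℤˣ) (-1) (p i) (t i) := by
  rw [Measure.map_apply (measurable_update_coord k a)
    (MeasurableSet.pi s.countable_toSet fun i _ => .of_discrete)]
  by_cases ha : a ∈ t k
  · have : (fun ω : Config => Function.update ω k a) ⁻¹' (Set.pi s t) =
        Set.pi (s.erase k : Finset ℕ) t := by
      ext ω
      simp only [Set.mem_preimage, Set.mem_pi, Finset.mem_coe, Finset.mem_erase]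
      refine ⟨fun h i hi => by simpa [Function.update_of_ne hi.1] using h i hi.2, fun h i hi => ?_⟩
      by_cases hik : i = k
      · subst hik; simpa using ha
      · simpa [Function.update_of_ne hik] using h i ⟨hik, hi⟩
    rw [this, Measure.infinitePi_pi _ fun _ _ => .of_discrete]
    simp [ha]
  · have : (fun ω : Config => Function.update ω k a) ⁻¹' (Set.pi s t) = ∅ := by
      ext ω
      simp only [Set.mem_preimage, Set.mem_pi, Set.mem_empty_iff_false, iff_false]
      intro h
      exact ha (by simpa using h k hk)
    rw [this]
    simp [ha]

/-- Resampling the `k`-th coordinate does not change the law. -/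
lemma law_eq_add (p : ℕ → unitInterval) (k : ℕ) :
    law p = ENNReal.ofReal (p k) • (law p).map (fun ω => Function.update ω k 1) +
      ENNReal.ofReal (1 - p k) • (law p).map (fun ω => Function.update ω k (-1)) := by
  symm
  have hsum : ENNReal.ofReal (p k) + ENNReal.ofReal (1 - p k) = 1 := by
    rw [← ENNReal.ofReal_add (p k).2.1 (by linarith [(p k).2.2])]
    simp
  refine Measure.eq_infinitePi _ fun s t _ => ?_
  have hbox : MeasurableSet (Set.pi (s : Set ℕ) t) :=
    MeasurableSet.pi s.countable_toSet fun i _ => .of_discrete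
  simp only [Measure.add_apply, Measure.smul_apply, smul_eq_mul]
  by_cases hk : k ∈ s
  · rw [law_map_update_pi p k _ s t hk, law_map_update_pi p k _ s t hk, ← mul_assoc, ← mul_assoc,
      ← add_mul, ← Finset.mul_prod_erase s _ hk]
    congr 1
    have e1 : ((unitInterval.toNNReal (p k) : ℝ≥0) : ℝ≥0∞) = ENNReal.ofReal (p k) := by
      rw [ENNReal.ofReal, ← Real.toNNReal_coe (r := unitInterval.toNNReal (p k))]; rfl
    have e2 : ((unitInterval.toNNReal (unitInterval.symm (p k)) : ℝ≥0) : ℝ≥0∞) =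
        ENNReal.ofReal (1 - p k) := by
      rw [ENNReal.ofReal, ← Real.toNNReal_coe (r := unitInterval.toNNReal _)]; rfl
    rw [bernoulliMeasure_def, Measure.add_apply, Measure.smul_apply, Measure.smul_apply,
      Measure.dirac_apply, Measure.dirac_apply, ENNReal.smul_def, ENNReal.smul_def, e1, e2]
    simp
  · have hpre : ∀ a : ℤˣ, (law p).map (fun ω => Function.update ω k a) (Set.pi s t) =
        ∏ i ∈ s, bernoulliMeasure (1 : ℤˣ) (-1) (p i) (t i) := fun a => by
      rw [Measure.map_apply (measurable_update_coord k a) hbox,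
        ← Measure.infinitePi_pi _ fun i _ => (MeasurableSet.of_discrete : MeasurableSet (t i))]
      congr 1
      ext ω
      simp only [Set.mem_preimage, Set.mem_pi, Finset.mem_coe]
      refine forall₂_congr fun i hi => ?_
      rw [Function.update_of_ne (ne_of_mem_of_not_mem hi hk)]
    rw [hpre, hpre, ← add_mul, hsum, one_mul]

lemma map_update_absolutelyContinuous (hp : ∀ k, 0 < (p k : ℝ) ∧ (p k : ℝ) < 1) (k : ℕ)
    (a : ℤˣ) : (law p).map (fun ω => Function.update ω k a) ≪ law p := by
  intro s hs
  rw [law_eq_add p k] at hs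
  simp only [Measure.add_apply, Measure.smul_apply, smul_eq_mul, add_eq_zero, mul_eq_zero,
    ENNReal.ofReal_eq_zero] at hs
  rcases Int.units_eq_one_or a with rfl | rfl
  · exact hs.1.resolve_left (not_le.2 (hp k).1)
  · exact hs.2.resolve_left (not_le.2 (by linarith [(hp k).2]))

lemma quasiMeasurePreserving_update (hp : ∀ k, 0 < (p k : ℝ) ∧ (p k : ℝ) < 1) (k : ℕ) (a : ℤˣ) :
    Measure.QuasiMeasurePreserving (fun ω : Config => Function.update ω k a) (law p) (law p) :=
  ⟨measurable_update_coord k a, map_update_absolutelyContinuous hp k a⟩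

lemma lintegral_eq_resample (hp : ∀ k, 0 < (p k : ℝ) ∧ (p k : ℝ) < 1) (k : ℕ)
    {G : Config → ℝ≥0∞} (hG : AEMeasurable G (law p)) :
    ∫⁻ ω, G ω ∂law p = ENNReal.ofReal (p k) * ∫⁻ ω, G (Function.update ω k 1) ∂law p +
      ENNReal.ofReal (1 - p k) * ∫⁻ ω, G (Function.update ω k (-1)) ∂law p := by
  conv_lhs => rw [law_eq_add p k]
  rw [lintegral_add_measure, lintegral_smul_measure, lintegral_smul_measure,
    lintegral_map' (hG.mono_ac (map_update_absolutelyContinuous hp k 1))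
      (measurable_update_coord k 1).aemeasurable,
    lintegral_map' (hG.mono_ac (map_update_absolutelyContinuous hp k (-1)))
      (measurable_update_coord k (-1)).aemeasurable]
  rfl

lemma integrable_update (hp : ∀ k, 0 < (p k : ℝ) ∧ (p k : ℝ) < 1) (k : ℕ) (a : ℤˣ)
    {G : Config → ℝ} (hG : Integrable G (law p)) :
    Integrable (fun ω => G (Function.update ω k a)) (law p) := by
  have h := hG
  rw [law_eq_add p k, integrable_add_measure, integrable_smul_measure, integrable_smul_measure] at h
  · rcases Int.units_eq_one_or a with rfl | rfl
    · exact h.1.comp_measurable (measurable_update_coord k 1)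
    · exact h.2.comp_measurable (measurable_update_coord k (-1))
  · simpa using (hp k).2
  · simp
  · simpa using (hp k).1
  · simp

lemma integral_eq_resample (hp : ∀ k, 0 < (p k : ℝ) ∧ (p k : ℝ) < 1) (k : ℕ)
    {G : Config → ℝ} (hG : Integrable G (law p)) :
    ∫ ω, G ω ∂law p = p k * ∫ ω, G (Function.update ω k 1) ∂law p +
      (1 - p k) * ∫ ω, G (Function.update ω k (-1)) ∂law p := by
  have h := hG
  rw [law_eq_add p k, integrable_add_measure] at h
  conv_lhs => rw [law_eq_add p k]
  rw [integral_add_measure h.1 h.2, integral_smul_measure, integral_smul_measure,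
    integral_map (measurable_update_coord k 1).aemeasurable
      (hG.1.mono_ac (map_update_absolutelyContinuous hp k 1)),
    integral_map (measurable_update_coord k (-1)).aemeasurable
      (hG.1.mono_ac (map_update_absolutelyContinuous hp k (-1))),
    ENNReal.toReal_ofReal (hp k).1.le, ENNReal.toReal_ofReal (by linarith [(hp k).2])]
  rfl

lemma memLp_update (hp : ∀ k, 0 < (p k : ℝ) ∧ (p k : ℝ) < 1) (k : ℕ) (a : ℤˣ)
    {G : Config → ℝ} (hG : MemLp G 2 (law p)) :
    MemLp (fun ω => G (Function.update ω k a)) 2 (law p) := by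
  refine (memLp_two_iff_integrable_sq (hG.1.comp_quasiMeasurePreserving
    (quasiMeasurePreserving_update hp k a))).2 ?_
  exact integrable_update hp k a hG.integrable_sq

/-! ### The Walsh basis -/

/-- The Walsh function `W_S = ∏_{i ∈ S} Yᵢ` of a finite set `S`. -/
def walsh (p : ℕ → unitInterval) (S : Finset ℕ) (ω : Config) : ℝ := ∏ i ∈ S, Y p i ω

lemma measurable_walsh (p : ℕ → unitInterval) (S : Finset ℕ) : Measurable (walsh p S) :=
  Finset.measurable_prod _ fun i _ => measurable_Y p i

lemma exists_abs_walsh_le (p : ℕ → unitInterval) (S : Finset ℕ) :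
    ∃ C, ∀ ω, |walsh p S ω| ≤ C :=
  ⟨_, fun ω => by
    rw [walsh, Finset.abs_prod]
    exact Finset.prod_le_prod (fun _ _ => abs_nonneg _) fun i _ => norm_Y_le p i ω⟩

lemma memLp_walsh (p : ℕ → unitInterval) (S : Finset ℕ) (q : ℝ≥0∞) :
    MemLp (walsh p S) q (law p) := by
  obtain ⟨C, hC⟩ := exists_abs_walsh_le p S
  exact MemLp.of_bound (measurable_walsh p S).aestronglyMeasurable C (Filter.Eventually.of_forall hC)

/-- The Walsh function as an element of `L²(Ω)`. -/
def walshLp (p : ℕ → unitInterval) (S : Finset ℕ) : Lp ℝ 2 (law p) := (memLp_walsh p S 2).toLp _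

lemma walsh_update_of_notMem (p : ℕ → unitInterval) {S : Finset ℕ} {k : ℕ} (hk : k ∉ S) (a : ℤˣ)
    (ω : Config) : walsh p S (Function.update ω k a) = walsh p S ω :=
  Finset.prod_congr rfl fun _ hi => Y_update_of_ne p (ne_of_mem_of_not_mem hi hk) a ω

lemma walsh_eq_mul_erase (p : ℕ → unitInterval) {S : Finset ℕ} {k : ℕ} (hk : k ∈ S) (ω : Config) :
    walsh p S ω = Y p k ω * walsh p (S.erase k) ω :=
  (Finset.mul_prod_erase S (fun i => Y p i ω) hk).symm

lemma integral_walsh_mul_self (hp : ∀ k, 0 < (p k : ℝ) ∧ (p k : ℝ) < 1) (S : Finset ℕ) :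
    ∫ ω, walsh p S ω * walsh p S ω ∂law p = 1 := by
  induction S using Finset.induction_on with
  | empty => simp [walsh]
  | insert k S hk ih =>
    have hσ := sigma_pos hp k
    have hσ2 := sigma_sq p k
    have hint : Integrable (fun ω => walsh p (insert k S) ω * walsh p (insert k S) ω) (law p) :=
      (memLp_walsh p _ 2).integrable_mul (memLp_walsh p _ 2)
    rw [integral_eq_resample hp k hint]
    have h1 : ∀ a : ℤˣ, ∀ ω, walsh p (insert k S) (Function.update ω k a) *
        walsh p (insert k S) (Function.update ω k a) =
          (Y p k (Function.update ω k a)) ^ 2 * (walsh p S ω * walsh p S ω) := fun a ω => by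
      rw [walsh, Finset.prod_insert hk, ← walsh, walsh_update_of_notMem p hk]
      ring
    simp_rw [h1, Y_update_one,
      Y_update_neg_one, integral_const_mul, ih]
    rw [div_pow, div_pow, hσ2]
    have := (hp k).1
    have : 0 < 1 - (p k : ℝ) := by linarith [(hp k).2]
    field_simp
    ring

lemma integral_walsh_mul_of_ne (hp : ∀ k, 0 < (p k : ℝ) ∧ (p k : ℝ) < 1) {S T : Finset ℕ}
    (hST : S ≠ T) : ∫ ω, walsh p S ω * walsh p T ω ∂law p = 0 := by
  wlog h : ∃ k ∈ S, k ∉ T generalizing S T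
  · have hST' : ∃ k ∈ T, k ∉ S := by
      by_contra hc
      push Not at hc h
      exact hST (Finset.Subset.antisymm h hc)
    rw [← this hST.symm hST']
    exact integral_congr_ae (Filter.Eventually.of_forall fun ω => mul_comm _ _)
  obtain ⟨k, hkS, hkT⟩ := h
  have hσ := sigma_pos hp k
  have hint : Integrable (fun ω => walsh p S ω * walsh p T ω) (law p) :=
    (memLp_walsh p _ 2).integrable_mul (memLp_walsh p _ 2)
  rw [integral_eq_resample hp k hint]
  have h1 : ∀ a : ℤˣ, ∀ ω, walsh p S (Function.update ω k a) *
      walsh p T (Function.update ω k a) =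
        Y p k (Function.update ω k a) * (walsh p (S.erase k) ω * walsh p T ω) := fun a ω => by
    rw [walsh_eq_mul_erase p hkS, walsh_update_of_notMem p hkT,
      walsh_update_of_notMem p (Finset.notMem_erase k S)]
    ring
  simp_rw [h1, Y_update_one,
    Y_update_neg_one, integral_const_mul]
  field_simp
  ring

lemma inner_walshLp (p : ℕ → unitInterval) (S : Finset ℕ) (G : Lp ℝ 2 (law p)) :
    inner ℝ (walshLp p S) G = ∫ ω, walsh p S ω * G ω ∂law p := by
  rw [L2.inner_def]
  refine integral_congr_ae ?_
  filter_upwards [(memLp_walsh p S 2).coeFn_toLp] with ω hω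
  rw [walshLp, hω, Real.inner_apply]

lemma orthonormal_walshLp (hp : ∀ k, 0 < (p k : ℝ) ∧ (p k : ℝ) < 1) :
    Orthonormal ℝ (walshLp p) := by
  classical
  rw [orthonormal_iff_ite]
  intro S T
  rw [inner_walshLp]
  have : ∫ ω, walsh p S ω * walshLp p T ω ∂law p = ∫ ω, walsh p S ω * walsh p T ω ∂law p := by
    refine integral_congr_ae ?_
    filter_upwards [(memLp_walsh p T 2).coeFn_toLp] with ω hω
    rw [walshLp, hω]
  rw [this]
  split_ifs with h
  · subst h; exact integral_walsh_mul_self hp S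
  · exact integral_walsh_mul_of_ne hp h

/-- Every function of one coordinate is affine in `Yᵢ`, so the indicator of a box is a linear
combination of Walsh functions. -/
lemma indicator_box_eq_sum_walsh (hp : ∀ k, 0 < (p k : ℝ) ∧ (p k : ℝ) < 1) (s : Finset ℕ)
    (t : ℕ → Set ℤˣ) : ∃ c : Finset ℕ → ℝ, ∀ ω : Config,
      (Set.pi (s : Set ℕ) t).indicator (fun _ => (1 : ℝ)) ω = ∑ T ∈ s.powerset, c T * walsh p T ω := by
  classical
  set e : ℕ → ℤˣ → ℝ := fun i a => (t i).indicator (fun _ => (1 : ℝ)) a with he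
  set b : ℕ → ℝ := fun i => (e i 1 - e i (-1)) * sigma p i with hb
  set a : ℕ → ℝ := fun i => p i * e i 1 + (1 - p i) * e i (-1) with ha
  have haff : ∀ i (ω : Config), e i (ω i) = b i * Y p i ω + a i := fun i ω => by
    have hσ := sigma_pos hp i
    rcases Int.units_eq_one_or (ω i) with h | h
    · rw [Y_of_eq_one p h, h, hb, ha]; field_simp; ring
    · rw [Y_of_eq_neg_one p h, h, hb, ha]; field_simp; ring
  refine ⟨fun T => (∏ i ∈ T, b i) * ∏ i ∈ s \ T, a i, fun ω => ?_⟩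
  have hprod : (Set.pi (s : Set ℕ) t).indicator (fun _ => (1 : ℝ)) ω = ∏ i ∈ s, e i (ω i) := by
    by_cases hω : ω ∈ Set.pi (s : Set ℕ) t
    · rw [Set.indicator_of_mem hω]
      exact (Finset.prod_eq_one fun i hi => Set.indicator_of_mem (hω i hi) _).symm
    · rw [Set.indicator_of_notMem hω]
      simp only [Set.mem_pi, not_forall] at hω
      obtain ⟨i, hi, hit⟩ := hω
      exact (Finset.prod_eq_zero hi (Set.indicator_of_notMem hit _)).symm
  rw [hprod, Finset.prod_congr rfl fun i _ => haff i ω, Finset.prod_add]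
  refine Finset.sum_congr rfl fun T _ => ?_
  rw [Finset.prod_mul_distrib, walsh]
  ring

/-- The Walsh functions are total in `L²(Ω)`. -/
lemma eq_zero_of_inner_walshLp (hp : ∀ k, 0 < (p k : ℝ) ∧ (p k : ℝ) < 1) (G : Lp ℝ 2 (law p))
    (hG : ∀ S, inner ℝ (walshLp p S) G = (0 : ℝ)) : G = 0 := by
  have hGm : MemLp G 2 (law p) := Lp.memLp G
  have hGi : Integrable G (law p) := hGm.integrable one_le_two
  have hW : ∀ S, ∫ ω, walsh p S ω * G ω ∂law p = 0 := fun S => by rw [← inner_walshLp, hG]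
  have hbox : ∀ (s : Finset ℕ) (t : ℕ → Set ℤˣ), ∫ ω in Set.pi (s : Set ℕ) t, G ω ∂law p = 0 := by
    intro s t
    obtain ⟨c, hc⟩ := indicator_box_eq_sum_walsh hp s t
    have hm : MeasurableSet (Set.pi (s : Set ℕ) t) :=
      MeasurableSet.pi s.countable_toSet fun i _ => .of_discrete
    rw [← integral_indicator hm]
    have : ∀ ω, (Set.pi (s : Set ℕ) t).indicator G ω =
        ∑ T ∈ s.powerset, c T * (walsh p T ω * G ω) := fun ω => by
      have : (Set.pi (s : Set ℕ) t).indicator G ω =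
          (Set.pi (s : Set ℕ) t).indicator (fun _ => (1 : ℝ)) ω * G ω := by
        rw [← Set.indicator_mul_left]
        simp
      rw [this, hc, Finset.sum_mul]
      exact Finset.sum_congr rfl fun T _ => by ring
    simp_rw [this]
    have hi : ∀ T ∈ s.powerset, Integrable (fun ω => c T * (walsh p T ω * G ω)) (law p) :=
      fun T _ => ((memLp_walsh p T 2).integrable_mul hGm).const_mul (c T)
    rw [integral_finsetSum _ hi]
    refine Finset.sum_eq_zero fun T _ => ?_
    rw [integral_const_mul, hW, mul_zero]
  have hall : ∀ s : Set Config, MeasurableSet s → ∫ ω in s, G ω ∂law p = 0 := by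
    refine MeasurableSpace.induction_on_inter
      (s := squareCylinders fun _ : ℕ => {s : Set ℤˣ | MeasurableSet s})
      generateFrom_squareCylinders.symm
      (isPiSystem_squareCylinders (fun _ => MeasurableSpace.isPiSystem_measurableSet)
        fun _ => (MeasurableSet.univ : MeasurableSet (Set.univ : Set ℤˣ))) (by simp) ?_ ?_ ?_
    · rintro _ ⟨s, t, _, rfl⟩
      exact hbox s t
    · intro s hs h
      have h2 := hbox ∅ fun _ => Set.univ
      simp only [Finset.coe_empty, Set.empty_pi, Measure.restrict_univ] at h2
      rw [← integral_add_compl hs hGi, h, zero_add] at h2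
      exact h2
    · intro f hd hf h
      rw [integral_iUnion hf hd hGi.integrableOn]
      simp [h]
  have h0 : (G : Config → ℝ) =ᵐ[law p] 0 :=
    ae_eq_zero_of_forall_setIntegral_eq_of_sigmaFinite (fun _ _ _ => hGi.integrableOn)
      fun s hs _ => hall s hs
  exact (Lp.eq_zero_iff_ae_eq_zero).2 h0

/-- The Walsh functions as a Hilbert basis of `L²(Ω)`. -/
def walshBasis (hp : ∀ k, 0 < (p k : ℝ) ∧ (p k : ℝ) < 1) :
    HilbertBasis (Finset ℕ) ℝ (Lp ℝ 2 (law p)) :=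
  HilbertBasis.mkOfOrthogonalEqBot (orthonormal_walshLp hp) <| by
    rw [Submodule.eq_bot_iff]
    intro G hG
    refine eq_zero_of_inner_walshLp hp G fun S => ?_
    exact (Submodule.mem_orthogonal _ _).1 hG _ (Submodule.subset_span ⟨S, rfl⟩)

lemma coe_walshBasis (hp : ∀ k, 0 < (p k : ℝ) ∧ (p k : ℝ) < 1) :
    ⇑(walshBasis hp) = walshLp p := HilbertBasis.coe_mkOfOrthogonalEqBot _ _

/-! ### Chaos expansions in the Walsh basis -/

lemma eq_of_inner_walshLp (hp : ∀ k, 0 < (p k : ℝ) ∧ (p k : ℝ) < 1) {G H : Lp ℝ 2 (law p)}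
    (h : ∀ S, inner ℝ (walshLp p S) G = (inner ℝ (walshLp p S) H : ℝ)) : G = H :=
  sub_eq_zero.1 <| eq_zero_of_inner_walshLp hp _ fun S => by rw [inner_sub_right, h, sub_self]

lemma inner_walshLp_toLp (p : ℕ → unitInterval) (S : Finset ℕ) {G : Config → ℝ}
    (hG : MemLp G 2 (law p)) :
    inner ℝ (walshLp p S) (hG.toLp G) = ∫ ω, walsh p S ω * G ω ∂law p := by
  rw [inner_walshLp]
  refine integral_congr_ae ?_
  filter_upwards [hG.coeFn_toLp] with ω hω
  rw [hω]

lemma inner_walshLp_walshLp (hp : ∀ k, 0 < (p k : ℝ) ∧ (p k : ℝ) < 1) (S T : Finset ℕ) :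
    inner ℝ (walshLp p S) (walshLp p T) = if S = T then (1 : ℝ) else 0 :=
  (orthonormal_iff_ite.1 (orthonormal_walshLp hp)) S T

lemma hasSum_walsh (hp : ∀ k, 0 < (p k : ℝ) ∧ (p k : ℝ) < 1) (G : Lp ℝ 2 (law p)) :
    HasSum (fun S => (inner ℝ (walshLp p S) G : ℝ) • walshLp p S) G := by
  have := (walshBasis hp).hasSum_repr G
  simp_rw [HilbertBasis.repr_apply_apply, coe_walshBasis] at this
  exact this

lemma hasSum_inner_mul_inner_walsh (hp : ∀ k, 0 < (p k : ℝ) ∧ (p k : ℝ) < 1)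
    (G H : Lp ℝ 2 (law p)) :
    HasSum (fun S => (inner ℝ (walshLp p S) G : ℝ) * inner ℝ (walshLp p S) H) (inner ℝ G H) := by
  have := (walshBasis hp).hasSum_inner_mul_inner G H
  simp_rw [coe_walshBasis] at this
  simpa only [real_inner_comm G] using this

/-- If `P n` has Walsh coefficients only at sets of cardinality `n`, and the coefficient of `G` at
`S` is that of `P |S|`, then `G = ∑ₙ P n`. -/
lemma hasSum_of_inner_walshLp (hp : ∀ k, 0 < (p k : ℝ) ∧ (p k : ℝ) < 1) {P : ℕ → Lp ℝ 2 (law p)}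
    {G : Lp ℝ 2 (law p)} (hP : ∀ n S, S.card ≠ n → inner ℝ (walshLp p S) (P n) = (0 : ℝ))
    (hG : ∀ S, inner ℝ (walshLp p S) G = (inner ℝ (walshLp p S) (P S.card) : ℝ)) :
    HasSum P G := by
  have h1 := (Equiv.sigmaFiberEquiv (Finset.card : Finset ℕ → ℕ)).hasSum_iff.2 (hasSum_walsh hp G)
  refine h1.sigma fun n => ?_
  have hs : Summable fun S : {S : Finset ℕ // S.card = n} =>
      (inner ℝ (walshLp p S.1) G : ℝ) • walshLp p S.1 :=
    (hasSum_walsh hp G).summable.comp_injective Subtype.val_injective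
  have he : ∑' S : {S : Finset ℕ // S.card = n},
      (inner ℝ (walshLp p S.1) G : ℝ) • walshLp p S.1 = P n := by
    refine eq_of_inner_walshLp hp fun T => ?_
    have h2 := hs.hasSum.mapL (innerSL ℝ (walshLp p T))
    simp only [innerSL_apply_apply, inner_smul_right, inner_walshLp_walshLp hp] at h2
    refine h2.unique ?_
    by_cases hT : T.card = n
    · convert hasSum_single (⟨T, hT⟩ : {S : Finset ℕ // S.card = n}) ?_ using 1
      · simp [hG, hT]
      · intro S hS
        have : T ≠ S.1 := fun h => hS (Subtype.ext h.symm)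
        simp [this]
    · rw [hP n T hT]
      convert! hasSum_zero using 2 with S
      have : T ≠ S.1 := fun h => hT (h ▸ S.2)
      simp [this]
  exact he ▸ hs.hasSum

lemma prodY_of_injective (p : ℕ → unitInterval) {n : ℕ} {i : Fin n → ℕ} (hi : i.Injective) :
    prodY p i = walshLp p (Finset.univ.image i) :=
  MemLp.toLp_congr _ _ <| Filter.Eventually.of_forall fun ω => by
    rw [walsh, Finset.prod_image fun a _ b _ h => hi h]

lemma smul_prodY_eq (p : ℕ → unitInterval) {n : ℕ} {f : (Fin n → ℕ) → ℝ}
    (hf : ∀ i : Fin n → ℕ, ¬ i.Injective → f i = 0) (i : Fin n → ℕ) :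
    f i • prodY p i = f i • walshLp p (Finset.univ.image i) := by
  by_cases hi : i.Injective
  · rw [prodY_of_injective p hi]
  · rw [hf i hi, zero_smul, zero_smul]

/-- Multiple integrals of order `n` have Walsh coefficients only at sets of cardinality `n`. -/
lemma inner_walshLp_J_of_card_ne (hp : ∀ k, 0 < (p k : ℝ) ∧ (p k : ℝ) < 1) {n : ℕ}
    {f : (Fin n → ℕ) → ℝ} (hf : ∀ i : Fin n → ℕ, ¬ i.Injective → f i = 0) {S : Finset ℕ}
    (hS : S.card ≠ n) : inner ℝ (walshLp p S) (J p f) = (0 : ℝ) := by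
  unfold J
  by_cases hs : Summable fun i => f i • prodY p i
  · have h2 := hs.hasSum.mapL (innerSL ℝ (walshLp p S))
    simp only [innerSL_apply_apply] at h2
    refine h2.unique ?_
    convert! hasSum_zero using 2 with i
    by_cases hi : i.Injective
    · have : S ≠ Finset.univ.image i := fun h => hS (by
        rw [h, Finset.card_image_of_injective _ hi, Finset.card_univ, Fintype.card_fin])
      rw [prodY_of_injective p hi, inner_smul_right, inner_walshLp_walshLp hp, if_neg this,
        mul_zero]
    · rw [hf i hi, zero_smul, inner_zero_right]
  -- without summability, `J p f` is the junk value `0`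
  · rw [tsum_eq_zero_of_not_summable hs, inner_zero_right]

/-- The tuples in `ℕⁿ` whose set of entries is `S`. -/
def tuples (n : ℕ) (S : Finset ℕ) : Finset (Fin n → ℕ) :=
  (Fintype.piFinset fun _ => S).filter fun i => Finset.univ.image i = S

lemma mem_tuples {n : ℕ} {S : Finset ℕ} {i : Fin n → ℕ} :
    i ∈ tuples n S ↔ Finset.univ.image i = S := by
  simp only [tuples, Finset.mem_filter, Fintype.mem_piFinset, and_iff_right_iff_imp]
  rintro rfl a
  exact Finset.mem_image_of_mem _ (Finset.mem_univ a)

lemma injective_of_mem_tuples {n : ℕ} {S : Finset ℕ} (hS : S.card = n) {i : Fin n → ℕ}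
    (hi : i ∈ tuples n S) : i.Injective := by
  rw [mem_tuples] at hi
  have : (Finset.univ.image i).card = (Finset.univ : Finset (Fin n)).card := by
    rw [hi, hS, Finset.card_univ, Fintype.card_fin]
  exact fun a b h => Finset.card_image_iff.1 this (Finset.mem_coe.2 (Finset.mem_univ a))
    (Finset.mem_coe.2 (Finset.mem_univ b)) h

lemma tuples_nonempty {n : ℕ} {S : Finset ℕ} (hS : S.card = n) : (tuples n S).Nonempty := by
  refine ⟨S.orderEmbOfFin hS, mem_tuples.2 ?_⟩
  rw [← Finset.coe_inj, Finset.coe_image, Finset.coe_univ, Set.image_univ,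
    Finset.range_orderEmbOfFin]

lemma card_tuples_le {n : ℕ} {S : Finset ℕ} (hS : S.card ≤ n) : (tuples n S).card ≤ n ^ n := by
  refine (Finset.card_filter_le _ _).trans ?_
  rw [Fintype.card_piFinset, Finset.prod_const, Finset.card_univ, Fintype.card_fin]
  exact Nat.pow_le_pow_left hS n

/-- The series defining `J` converges: every Walsh function occurs at boundedly many tuples. -/
lemma summable_smul_prodY (hp : ∀ k, 0 < (p k : ℝ) ∧ (p k : ℝ) < 1) {n : ℕ}
    {f : (Fin n → ℕ) → ℝ} (hf : ∀ i : Fin n → ℕ, ¬ i.Injective → f i = 0)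
    (hsq : Summable fun i => f i ^ 2) : Summable fun i => f i • prodY p i := by
  simp_rw [smul_prodY_eq p hf]
  have hbound : ∀ t : Finset (Fin n → ℕ), ‖∑ i ∈ t, f i • walshLp p (Finset.univ.image i)‖ ^ 2 ≤
      (n : ℝ) ^ n * ∑ i ∈ t, f i ^ 2 := by
    intro t
    have hmaps : ∀ i ∈ t, Finset.univ.image i ∈ t.image fun i => Finset.univ.image i :=
      fun i hi => Finset.mem_image_of_mem _ hi
    have e1 : ∑ i ∈ t, f i • walshLp p (Finset.univ.image i) =
        ∑ S ∈ t.image fun i => Finset.univ.image i,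
          (∑ i ∈ t with Finset.univ.image i = S, f i) • walshLp p S := by
      rw [← Finset.sum_fiberwise_of_maps_to hmaps]
      refine Finset.sum_congr rfl fun S _ => ?_
      rw [Finset.sum_smul]
      refine Finset.sum_congr rfl fun i hi => ?_
      rw [(Finset.mem_filter.1 hi).2]
    rw [e1, ← real_inner_self_eq_norm_sq, (orthonormal_walshLp hp).inner_sum,
      ← Finset.sum_fiberwise_of_maps_to hmaps, Finset.mul_sum]
    refine Finset.sum_le_sum fun S hS => ?_
    simp only [conj_trivial, ← sq]
    refine sq_sum_le_card_mul_sum_sq.trans ?_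
    refine mul_le_mul_of_nonneg_right ?_ (Finset.sum_nonneg fun _ _ => sq_nonneg _)
    have hSn : S.card ≤ n := by
      obtain ⟨i, _, rfl⟩ := Finset.mem_image.1 hS
      exact Finset.card_image_le.trans_eq (by simp)
    have : (t.filter fun i => Finset.univ.image i = S).card ≤ n ^ n :=
      (Finset.card_le_card fun i hi => mem_tuples.2 (Finset.mem_filter.1 hi).2).trans
        (card_tuples_le hSn)
    exact_mod_cast this
  rw [summable_iff_vanishing_norm]
  intro ε hε
  have hC : (0 : ℝ) < (n : ℝ) ^ n + 1 := by positivity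
  obtain ⟨s, hs⟩ := summable_iff_vanishing_norm.1 hsq (ε ^ 2 / ((n : ℝ) ^ n + 1)) (by positivity)
  refine ⟨s, fun t ht => ?_⟩
  have h1 := hs t ht
  have h0 : 0 ≤ ∑ i ∈ t, f i ^ 2 := Finset.sum_nonneg fun _ _ => sq_nonneg _
  rw [Real.norm_eq_abs, abs_of_nonneg h0, lt_div_iff₀ hC] at h1
  refine lt_of_pow_lt_pow_left₀ 2 hε.le ((hbound t).trans_lt (lt_of_le_of_lt ?_ h1))
  rw [mul_comm]
  exact mul_le_mul_of_nonneg_left (by linarith) h0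

/-- The kernel of order `n` with prescribed Walsh coefficients `c`, which distributes `c S` evenly
over the orderings of `S`. -/
def kernelOf (n : ℕ) (c : Finset ℕ → ℝ) (i : Fin n → ℕ) : ℝ :=
  open Classical in if i.Injective then
    c (Finset.univ.image i) / (tuples n (Finset.univ.image i)).card else 0

lemma kernelOf_of_mem_tuples {n : ℕ} {c : Finset ℕ → ℝ} {S : Finset ℕ} (hS : S.card = n)
    {i : Fin n → ℕ} (hi : i ∈ tuples n S) : kernelOf n c i = c S / (tuples n S).card := by
  rw [kernelOf, if_pos (injective_of_mem_tuples hS hi), mem_tuples.1 hi]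

lemma isKernel_kernelOf (n : ℕ) {c : Finset ℕ → ℝ} (hc : Summable fun S => c S ^ 2) :
    IsKernel (kernelOf n c) where
  summable_sq := by
    refine summable_of_sum_le (c := ∑' S, c S ^ 2) (fun _ => sq_nonneg _) fun t => ?_
    have hmaps : ∀ i ∈ t, Finset.univ.image i ∈ t.image fun i => Finset.univ.image i :=
      fun i hi => Finset.mem_image_of_mem _ hi
    rw [← Finset.sum_fiberwise_of_maps_to hmaps]
    refine le_trans (Finset.sum_le_sum fun S _ => ?_) (hc.sum_le_tsum _ fun _ _ => sq_nonneg _)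
    set N := (tuples n S).card with hN
    have hterm : ∀ i ∈ t.filter fun i => Finset.univ.image i = S,
        kernelOf n c i ^ 2 ≤ c S ^ 2 / (N : ℝ) ^ 2 := fun i hi => by
      have hiS := (Finset.mem_filter.1 hi).2
      unfold kernelOf
      split_ifs with h
      · rw [hiS, div_pow]
      · rw [zero_pow two_ne_zero]
        positivity
    refine (Finset.sum_le_card_nsmul _ _ _ hterm).trans ?_
    rw [nsmul_eq_mul]
    have hcard : (t.filter fun i => Finset.univ.image i = S).card ≤ N :=
      Finset.card_le_card fun i hi => mem_tuples.2 (Finset.mem_filter.1 hi).2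
    have hcard' : ((t.filter fun i => Finset.univ.image i = S).card : ℝ) ≤ N := by
      exact_mod_cast hcard
    rcases Nat.eq_zero_or_pos N with h0 | hpos
    · simp [h0, sq_nonneg]
    · have hN1 : (1 : ℝ) ≤ N := by exact_mod_cast hpos
      calc _ ≤ (N : ℝ) * (c S ^ 2 / (N : ℝ) ^ 2) := by gcongr
        _ = c S ^ 2 / N := by field_simp
        _ ≤ c S ^ 2 := div_le_self (sq_nonneg _) hN1
  symm τ i := by
    have h1 : Finset.univ.image (i ∘ τ) = Finset.univ.image i := by
      rw [← Finset.image_image, Finset.image_univ_equiv]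
    unfold kernelOf
    rw [h1]
    simp only [EquivLike.injective_comp]
  diag i hi := if_neg hi

lemma inner_walshLp_J_kernelOf (hp : ∀ k, 0 < (p k : ℝ) ∧ (p k : ℝ) < 1) {c : Finset ℕ → ℝ}
    (hc : Summable fun S => c S ^ 2) (S : Finset ℕ) :
    inner ℝ (walshLp p S) (J p (kernelOf S.card c)) = c S := by
  have hk := isKernel_kernelOf S.card hc
  have h2 := (summable_smul_prodY hp hk.diag hk.summable_sq).hasSum.mapL
    (innerSL ℝ (walshLp p S))
  simp only [innerSL_apply_apply, smul_prodY_eq p hk.diag, inner_smul_right,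
    inner_walshLp_walshLp hp] at h2
  have h3 : HasSum (fun i : Fin S.card → ℕ => kernelOf S.card c i *
      if S = Finset.univ.image i then (1 : ℝ) else 0)
      (∑ i ∈ tuples S.card S, kernelOf S.card c i *
        if S = Finset.univ.image i then (1 : ℝ) else 0) :=
    hasSum_sum_of_ne_finset_zero fun i hi => by
      rw [if_neg fun h => hi (mem_tuples.2 h.symm), mul_zero]
  have h4 : ∑ i ∈ tuples S.card S, kernelOf S.card c i *
      (if S = Finset.univ.image i then (1 : ℝ) else 0) = c S := by
    rw [Finset.sum_congr rfl fun i hi => by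
      rw [kernelOf_of_mem_tuples rfl hi, if_pos (mem_tuples.1 hi).symm, mul_one],
      Finset.sum_const, nsmul_eq_mul]
    have : ((tuples S.card S).card : ℝ) ≠ 0 := by
      exact_mod_cast (tuples_nonempty rfl).card_pos.ne'
    field_simp
  rw [h4] at h3
  unfold J
  simp only [smul_prodY_eq p hk.diag]
  exact h2.unique h3

lemma exists_isChaosRepresentation (hp : ∀ k, 0 < (p k : ℝ) ∧ (p k : ℝ) < 1) {G : Config → ℝ}
    (hG : MemLp G 2 (law p)) : ∃ f, IsChaosRepresentation p G f := by
  set c : Finset ℕ → ℝ := fun S => inner ℝ (walshLp p S) (hG.toLp G) with hcd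
  have hc : Summable fun S => c S ^ 2 := by
    refine (hasSum_inner_mul_inner_walsh hp (hG.toLp G) (hG.toLp G)).summable.congr fun S => ?_
    rw [hcd, sq]
  refine ⟨fun n => kernelOf n c, fun n => isKernel_kernelOf n hc, ?_, hG, ?_⟩
  · funext i
    have h1 : i ∈ tuples 0 ∅ := mem_tuples.2 (by simp)
    have h2 : (tuples 0 ∅).card = 1 :=
      le_antisymm (card_tuples_le (n := 0) (by simp)) (Finset.card_pos.2 ⟨i, h1⟩)
    change kernelOf 0 c i = _
    rw [kernelOf_of_mem_tuples Finset.card_empty h1, h2, hcd]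
    simp only [Nat.cast_one, div_one]
    rw [inner_walshLp_toLp]
    simp [walsh]
  · refine hasSum_of_inner_walshLp hp
      (fun n S hS => inner_walshLp_J_of_card_ne hp (isKernel_kernelOf n hc).diag hS) fun S => ?_
    rw [inner_walshLp_J_kernelOf hp hc]

/-- The Walsh coefficients of `L⁻¹G`; the coefficient at `∅` is `0` since `1 / 0 = 0`. -/
lemma inner_walshLp_invL (hp : ∀ k, 0 < (p k : ℝ) ∧ (p k : ℝ) < 1) {G : Config → ℝ}
    (hG : MemLp G 2 (law p)) (S : Finset ℕ) :
    inner ℝ (walshLp p S) (invL p G) = -(1 / (S.card : ℝ) * inner ℝ (walshLp p S) (hG.toLp G)) := by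
  have hex := exists_isChaosRepresentation hp hG
  have hrep : IsChaosRepresentation p G (chaosKernel p G) := by
    rw [chaosKernel, dif_pos hex]
    exact hex.choose_spec
  obtain ⟨hker, -, hG', hsum⟩ := hrep
  set P : ℕ → Lp ℝ 2 (law p) := fun n => J p (chaosKernel p G n) with hPd
  have hP : ∀ n T, T.card ≠ n → inner ℝ (walshLp p T) (P n) = (0 : ℝ) := fun n T hT =>
    inner_walshLp_J_of_card_ne hp (hker n).diag hT
  have hcoef : ∀ T, inner ℝ (walshLp p T) (hG.toLp G) =
      (inner ℝ (walshLp p T) (P T.card) : ℝ) := fun T => by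
    have h2 := hsum.mapL (innerSL ℝ (walshLp p T))
    simp only [innerSL_apply_apply] at h2
    exact h2.unique (hasSum_single _ fun n hn => hP n T hn.symm)
  have hmem : Memℓp (fun T : Finset ℕ => 1 / (T.card : ℝ) * inner ℝ (walshLp p T) (hG.toLp G)) 2 := by
    refine memℓp_gen ?_
    refine Summable.of_nonneg_of_le (fun _ => by positivity) (fun T => ?_)
      (hasSum_inner_mul_inner_walsh hp (hG.toLp G) (hG.toLp G)).summable
    have h1 : |1 / (T.card : ℝ)| ≤ 1 := by
      rw [abs_of_nonneg (by positivity)]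
      rcases Nat.eq_zero_or_pos T.card with h | h
      · simp [h]
      · exact div_le_one_of_le₀ (by exact_mod_cast h) (by positivity)
    simp only [ENNReal.toReal_ofNat, Real.rpow_ofNat, norm_mul, Real.norm_eq_abs, mul_pow, sq_abs]
    rw [← sq]
    refine mul_le_of_le_one_left (sq_nonneg _) ?_
    rw [← sq_abs]
    exact pow_le_one₀ (abs_nonneg _) h1
  -- the `n`-th coefficient `1 / n` vanishes at `n = 0`, so the sum over `n ≥ 1` is the full one
  set x : Lp ℝ 2 (law p) := (walshBasis hp).repr.symm ⟨_, hmem⟩ with hx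
  have hxc : ∀ T, inner ℝ (walshLp p T) x =
      1 / (T.card : ℝ) * inner ℝ (walshLp p T) (hG.toLp G) := fun T => by
    have := (walshBasis hp).repr_apply_apply x T
    rw [coe_walshBasis] at this
    rw [← this, hx, LinearIsometryEquiv.apply_symm_apply]
  have hxs : HasSum (fun n : ℕ => (1 / (n : ℝ)) • P n) x := by
    refine hasSum_of_inner_walshLp hp (fun n T hT => ?_) fun T => ?_
    · rw [inner_smul_right, hP n T hT, mul_zero]
    · rw [hxc, inner_smul_right, hcoef]
  have hshift := (hasSum_nat_add_iff' 1).2 hxs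
  simp only [Finset.sum_range_one, Nat.cast_zero, div_zero, zero_smul, sub_zero, Nat.cast_add,
    Nat.cast_one] at hshift
  rw [invL, hshift.tsum_eq, inner_neg_right, hxc]

/-! ### The gradient and the covariance formula -/

lemma grad_update (p : ℕ → unitInterval) (k : ℕ) (G : Config → ℝ) (ω : Config) (a : ℤˣ) :
    grad p k G (Function.update ω k a) = grad p k G ω := by
  simp [grad]

lemma memLp_grad (hp : ∀ k, 0 < (p k : ℝ) ∧ (p k : ℝ) < 1) (k : ℕ) {G : Config → ℝ}
    (hG : MemLp G 2 (law p)) : MemLp (grad p k G) 2 (law p) :=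
  ((memLp_update hp k 1 hG).sub (memLp_update hp k (-1) hG)).const_mul (sigma p k)

/-- The Walsh coefficient `E[W_S G]`. -/
def walshCoef (p : ℕ → unitInterval) (G : Config → ℝ) (S : Finset ℕ) : ℝ :=
  ∫ ω, walsh p S ω * G ω ∂law p

lemma hasSum_walshCoef_mul (hp : ∀ k, 0 < (p k : ℝ) ∧ (p k : ℝ) < 1) {G H : Config → ℝ}
    (hG : MemLp G 2 (law p)) (hH : MemLp H 2 (law p)) :
    HasSum (fun S => walshCoef p G S * walshCoef p H S) (∫ ω, G ω * H ω ∂law p) := by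
  have h := hasSum_inner_mul_inner_walsh hp (hG.toLp G) (hH.toLp H)
  simp_rw [inner_walshLp_toLp] at h
  have e : (inner ℝ (hG.toLp G) (hH.toLp H) : ℝ) = ∫ ω, G ω * H ω ∂law p := by
    rw [L2.inner_def]
    refine integral_congr_ae ?_
    filter_upwards [hG.coeFn_toLp, hH.coeFn_toLp] with ω h1 h2
    rw [h1, h2, Real.inner_apply]
  rwa [e] at h

/-- `Dₖ` lowers Walsh functions: `Dₖ W_{S ∪ {k}} = W_S` and `Dₖ W_S = 0` for `k ∉ S`. -/
lemma walshCoef_grad (hp : ∀ k, 0 < (p k : ℝ) ∧ (p k : ℝ) < 1) (k : ℕ) {G : Config → ℝ}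
    (hG : MemLp G 2 (law p)) (S : Finset ℕ) :
    walshCoef p (grad p k G) S = if k ∈ S then 0 else walshCoef p G (insert k S) := by
  have hσ := sigma_pos hp k
  have hσ2 := sigma_sq p k
  unfold walshCoef
  split_ifs with hk
  · have hint : Integrable (fun ω => walsh p S ω * grad p k G ω) (law p) :=
      (memLp_walsh p S 2).integrable_mul (memLp_grad hp k hG)
    rw [integral_eq_resample hp k hint]
    simp_rw [grad_update, walsh_eq_mul_erase p hk, walsh_update_of_notMem p
      (Finset.notMem_erase k S), Y_update_one, Y_update_neg_one, mul_assoc, integral_const_mul]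
    field_simp
    ring
  · have hint : Integrable (fun ω => walsh p (insert k S) ω * G ω) (law p) :=
      (memLp_walsh p _ 2).integrable_mul hG
    have hw : ∀ ω, walsh p (insert k S) ω = Y p k ω * walsh p S ω := fun ω => by
      rw [walsh, Finset.prod_insert hk, walsh]
    have i1 : ∀ a, Integrable (fun ω => walsh p S ω * G (Function.update ω k a)) (law p) :=
      fun a => (memLp_walsh p S 2).integrable_mul (memLp_update hp k a hG)
    rw [integral_eq_resample hp k hint]
    simp_rw [hw, walsh_update_of_notMem p hk, Y_update_one, Y_update_neg_one, mul_assoc,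
      integral_const_mul]
    have e : ∀ ω, walsh p S ω * grad p k G ω =
        sigma p k * (walsh p S ω * G (Function.update ω k 1) -
          walsh p S ω * G (Function.update ω k (-1))) := fun ω => by
      rw [grad]; ring
    simp_rw [e]
    rw [integral_const_mul, integral_sub (i1 1) (i1 (-1))]
    field_simp
    rw [hσ2]
    ring

/-- `E[DₖG DₖH]` in terms of the Walsh coefficients of `G` and `H`. -/
lemma hasSum_integral_grad_mul_grad (hp : ∀ k, 0 < (p k : ℝ) ∧ (p k : ℝ) < 1) (k : ℕ)
    {G H : Config → ℝ} (hG : MemLp G 2 (law p)) (hH : MemLp H 2 (law p)) :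
    HasSum (fun S => if k ∈ S then walshCoef p G S * walshCoef p H S else 0)
      (∫ ω, grad p k G ω * grad p k H ω ∂law p) := by
  have h := hasSum_walshCoef_mul hp (memLp_grad hp k hG) (memLp_grad hp k hH)
  -- reindex by the involution that toggles the membership of `k`
  set e : Finset ℕ ≃ Finset ℕ := Function.Involutive.toPerm (fun S => symmDiff S {k})
    fun S => symmDiff_symmDiff_cancel_right {k} S with he
  rw [← e.hasSum_iff]
  refine h.congr_fun fun S => ?_
  rw [walshCoef_grad hp k hG, walshCoef_grad hp k hH]
  have hes : e S = symmDiff S {k} := rfl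
  by_cases hk : k ∈ S
  · have : k ∉ symmDiff S {k} := by simp [Finset.mem_symmDiff, hk]
    simp [hes, this, hk]
  · have h1 : k ∈ symmDiff S {k} := by simp [Finset.mem_symmDiff, hk]
    have h2 : symmDiff S {k} = insert k S := by
      ext i
      simp only [Finset.mem_symmDiff, Finset.mem_singleton, Finset.mem_insert]
      constructor
      · rintro (h | h)
        · exact Or.inr h.1
        · exact Or.inl h.1
      · rintro (rfl | h)
        · exact Or.inr ⟨rfl, hk⟩
        · exact Or.inl ⟨h, fun h' => hk (h' ▸ h)⟩
    simp [hes, h2, hk]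

lemma hasSum_ite_mem (S : Finset ℕ) (x : ℝ) :
    HasSum (fun k => if k ∈ S then x else 0) (S.card * x) := by
  have := hasSum_sum_of_ne_finset_zero (f := fun k => if k ∈ S then x else 0) (s := S)
    (L := SummationFilter.unconditional ℕ) fun k hk => if_neg hk
  rwa [Finset.sum_congr rfl fun k hk => if_pos hk, Finset.sum_const, nsmul_eq_mul] at this

/-- Summing over `k` the sums over the sets that contain `k` counts every set `|S|` times. -/
lemma hasSum_of_hasSum_mem {a : Finset ℕ → ℝ} (ha : Summable fun S => (S.card : ℝ) * a S)
    {b : ℕ → ℝ} (hb : ∀ k, HasSum (fun S => if k ∈ S then a S else 0) (b k)) :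
    HasSum b (∑' S, (S.card : ℝ) * a S) := by
  set f : Finset ℕ × ℕ → ℝ := fun x => if x.2 ∈ x.1 then a x.1 else 0 with hf
  have hs : Summable f := by
    rw [← summable_abs_iff]
    rw [summable_prod_of_nonneg fun _ => abs_nonneg _]
    have e : ∀ S : Finset ℕ, (fun k => |f (S, k)|) = fun k => if k ∈ S then |a S| else 0 :=
      fun S => by
        funext k
        simp only [hf]
        split_ifs <;> simp
    refine ⟨fun S => ?_, ?_⟩
    · rw [e]; exact (hasSum_ite_mem S _).summable
    · refine ha.abs.congr fun S => ?_
      rw [e, (hasSum_ite_mem S _).tsum_eq, abs_mul, Nat.abs_cast]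
  have h1 := hs.hasSum.prod_fiberwise fun S => hasSum_ite_mem S (a S)
  rw [h1.tsum_eq]
  exact ((Equiv.prodComm ℕ (Finset ℕ)).hasSum_iff.2 hs.hasSum).prod_fiberwise hb

lemma walshCoef_invL (hp : ∀ k, 0 < (p k : ℝ) ∧ (p k : ℝ) < 1) {G : Config → ℝ}
    (hG : MemLp G 2 (law p)) (S : Finset ℕ) :
    walshCoef p (invL p G) S = -(1 / (S.card : ℝ) * walshCoef p G S) := by
  rw [walshCoef, ← inner_walshLp, inner_walshLp_invL hp hG, inner_walshLp_toLp, walshCoef]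

lemma summable_walshCoef_mul (hp : ∀ k, 0 < (p k : ℝ) ∧ (p k : ℝ) < 1) {G H : Config → ℝ}
    (hG : MemLp G 2 (law p)) (hH : MemLp H 2 (law p)) :
    Summable fun S => walshCoef p G S * walshCoef p H S :=
  (hasSum_walshCoef_mul hp hG hH).summable

lemma summable_integral_sq_grad_invL (hp : ∀ k, 0 < (p k : ℝ) ∧ (p k : ℝ) < 1)
    {G : Config → ℝ} (hG : MemLp G 2 (law p)) :
    Summable fun k => ∫ ω, grad p k (invL p G) ω ^ 2 ∂law p := by
  have hV : MemLp (invL p G) 2 (law p) := Lp.memLp _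
  simp_rw [sq]
  refine (hasSum_of_hasSum_mem (a := fun S => walshCoef p (invL p G) S * walshCoef p (invL p G) S)
    ?_ fun k => hasSum_integral_grad_mul_grad hp k hV hV).summable
  refine Summable.of_nonneg_of_le (fun S => mul_nonneg (Nat.cast_nonneg _) (mul_self_nonneg _))
    (fun S => ?_) (summable_walshCoef_mul hp hG hG)
  rw [walshCoef_invL hp hG]
  rcases Nat.eq_zero_or_pos S.card with h | h
  · simp [h, mul_self_nonneg]
  · have h1 : (1 : ℝ) ≤ S.card := by exact_mod_cast h
    calc (S.card : ℝ) * (-(1 / (S.card : ℝ) * walshCoef p G S) *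
          -(1 / (S.card : ℝ) * walshCoef p G S))
        = walshCoef p G S * walshCoef p G S / S.card := by field_simp
      _ ≤ walshCoef p G S * walshCoef p G S := div_le_self (mul_self_nonneg _) h1

/-- The covariance formula, with the sum outside the expectation. -/
lemma hasSum_integral_grad_mul_neg_grad_invL (hp : ∀ k, 0 < (p k : ℝ) ∧ (p k : ℝ) < 1)
    {G H : Config → ℝ} (hG : MemLp G 2 (law p)) (hG0 : ∫ ω, G ω ∂law p = 0)
    (hH : MemLp H 2 (law p)) :
    HasSum (fun k => ∫ ω, grad p k H ω * -grad p k (invL p G) ω ∂law p)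
      (∫ ω, G ω * H ω ∂law p) := by
  have hV : MemLp (invL p G) 2 (law p) := Lp.memLp _
  have hempty : walshCoef p G ∅ = 0 := by simpa [walshCoef, walsh] using hG0
  have e : ∀ S : Finset ℕ, (S.card : ℝ) * -(walshCoef p H S * walshCoef p (invL p G) S) =
      walshCoef p G S * walshCoef p H S := fun S => by
    rw [walshCoef_invL hp hG]
    rcases S.eq_empty_or_nonempty with rfl | h
    · simp [hempty]
    · have : (S.card : ℝ) ≠ 0 := by exact_mod_cast h.card_pos.ne'
      field_simp
  have hs := hasSum_walshCoef_mul hp hG hH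
  rw [← hs.tsum_eq, ← tsum_congr e]
  refine hasSum_of_hasSum_mem (hs.summable.congr fun S => (e S).symm) fun k => ?_
  have h1 := (hasSum_integral_grad_mul_grad hp k hH hV).neg
  rw [← integral_neg] at h1
  simp_rw [mul_neg]
  refine h1.congr_fun fun S => ?_
  split_ifs <;> simp

/-- The Cauchy-Schwarz inequality for two sequences in `L²(μ; ℓ²)`. -/
lemma summable_integral_abs_mul {α : Type*} [MeasurableSpace α] {μ : Measure α} {u v : ℕ → α → ℝ}
    (hu : ∀ k, MemLp (u k) 2 μ) (hv : ∀ k, MemLp (v k) 2 μ)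
    (hsu : Summable fun k => ∫ x, u k x ^ 2 ∂μ) (hsv : Summable fun k => ∫ x, v k x ^ 2 ∂μ) :
    Summable fun k => ∫ x, ‖u k x * v k x‖ ∂μ := by
  refine Summable.of_nonneg_of_le (fun k => integral_nonneg fun x => norm_nonneg _) (fun k => ?_)
    (hsu.add hsv)
  rw [← integral_add (hu k).integrable_sq (hv k).integrable_sq]
  refine integral_mono ((hu k).integrable_mul (hv k)).norm
    ((hu k).integrable_sq.add (hv k).integrable_sq) fun x => ?_
  change ‖u k x * v k x‖ ≤ u k x ^ 2 + v k x ^ 2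
  rw [Real.norm_eq_abs, abs_mul, ← sq_abs (u k x), ← sq_abs (v k x)]
  nlinarith [sq_nonneg (|u k x| - |v k x|), sq_nonneg |u k x|, sq_nonneg |v k x|]

lemma tsum_lintegral_enorm_ne_top {α : Type*} [MeasurableSpace α] {μ : Measure α}
    {f : ℕ → α → ℝ} (hf : ∀ k, Integrable (f k) μ) (hs : Summable fun k => ∫ x, ‖f k x‖ ∂μ) :
    ∑' k, ∫⁻ x, ‖f k x‖ₑ ∂μ ≠ ∞ := by
  have e : ∀ k, ∫⁻ x, ‖f k x‖ₑ ∂μ = ENNReal.ofReal (∫ x, ‖f k x‖ ∂μ) := fun k =>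
    (ofReal_integral_norm_eq_lintegral_enorm (hf k)).symm
  simp_rw [e]
  exact hs.tsum_ofReal_ne_top

lemma ae_summable_of_summable_integral_norm {α : Type*} [MeasurableSpace α] {μ : Measure α}
    {f : ℕ → α → ℝ} (hf : ∀ k, Integrable (f k) μ) (hs : Summable fun k => ∫ x, ‖f k x‖ ∂μ) :
    ∀ᵐ x ∂μ, Summable fun k => f k x := by
  have h := summable_norm_of_tsum_eLpNorm_ne_top le_rfl (fun k => (hf k).aestronglyMeasurable) (by
    simp_rw [eLpNorm_one_eq_lintegral_enorm]
    exact tsum_lintegral_enorm_ne_top hf hs)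
  filter_upwards [h] with x hx using hx.of_norm

lemma integrable_tsum_of_summable_integral_norm {α : Type*} [MeasurableSpace α] {μ : Measure α}
    {f : ℕ → α → ℝ} (hf : ∀ k, Integrable (f k) μ) (hs : Summable fun k => ∫ x, ‖f k x‖ ∂μ) :
    Integrable (fun x => ∑' k, f k x) μ := by
  refine ⟨?_, ?_⟩
  · refine aestronglyMeasurable_of_tendsto_ae Filter.atTop
      (f := fun n x => ∑ k ∈ Finset.range n, f k x)
      (fun n => Finset.aestronglyMeasurable_fun_sum _ fun k _ => (hf k).aestronglyMeasurable) ?_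
    filter_upwards [ae_summable_of_summable_integral_norm hf hs] with x hx
    exact hx.hasSum.tendsto_sum_nat
  · refine lt_of_le_of_lt (lintegral_mono fun x => enorm_tsum_le_tsum_enorm) ?_
    rw [lintegral_tsum fun k => (hf k).aestronglyMeasurable.enorm]
    exact (tsum_lintegral_enorm_ne_top hf hs).lt_top

/-! ### Taylor expansion on the integers -/

lemma abs_sub_le_of_abs_succ_sub_le {f : ℕ → ℝ} {δ : ℝ} (hf : ∀ j, |f (j + 1) - f j| ≤ δ)
    (b n : ℕ) : |f (b + n) - f b| ≤ δ * n := by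
  induction n with
  | zero => simp
  | succ n ih =>
    have h1 := hf (b + n)
    have h2 := abs_add_le (f (b + n + 1) - f (b + n)) (f (b + n) - f b)
    rw [sub_add_sub_cancel] at h2
    rw [← add_assoc]
    push_cast
    linarith

lemma abs_sub_le_mul_abs {f : ℕ → ℝ} {δ : ℝ} (hf : ∀ j, |f (j + 1) - f j| ≤ δ) (a b : ℕ) :
    |f a - f b| ≤ δ * |(a : ℝ) - b| := by
  rcases le_total b a with h | h <;> obtain ⟨n, rfl⟩ := Nat.exists_eq_add_of_le h
  · simpa using abs_sub_le_of_abs_succ_sub_le hf b n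
  · rw [abs_sub_comm, abs_sub_comm (a : ℝ)]
    simpa using abs_sub_le_of_abs_succ_sub_le hf a n

/-- First-order Taylor expansion at `b`. The error is at most `2δ(n - 1)` if `a = b + n` with
`n ≥ 1`, and at most `2δn` if `a = b - n`; for integers both are dominated by the quadratic bound. -/
lemma abs_taylor_le {f : ℕ → ℝ} {δ : ℝ} (hf : ∀ j, |f (j + 1) - f j| ≤ δ) (a b : ℕ) :
    |f a - f b - (f (b + 1) - f b) * ((a : ℝ) - b)| ≤
      δ * (((a : ℝ) - b) * ((a : ℝ) - b - 1)) := by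
  have hδ : 0 ≤ δ := (abs_nonneg _).trans (hf 0)
  rcases le_total b a with h | h <;> obtain ⟨n, rfl⟩ := Nat.exists_eq_add_of_le h
  · have e : ((b + n : ℕ) : ℝ) - b = n := by push_cast; ring
    rw [e]
    clear h e
    induction n with
    | zero => simp
    | succ n ih =>
      rcases Nat.eq_zero_or_pos n with rfl | hn
      · simp
      · have hn1 : (1 : ℝ) ≤ n := by exact_mod_cast hn
        have h1 := abs_le.1 (hf (b + n))
        have h2 := abs_le.1 (hf b)
        have h3 := abs_le.1 ih
        rw [← add_assoc]
        push_cast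
        have h4 : δ ≤ δ * n := le_mul_of_one_le_right hδ hn1
        refine abs_le.2 ⟨?_, ?_⟩ <;> linarith
  · have h1 := abs_le.1 (abs_sub_le_of_abs_succ_sub_le hf a n)
    have h2 := abs_le.1 (hf (a + n))
    have e : (a : ℝ) - ((a + n : ℕ) : ℝ) = -n := by push_cast; ring
    rw [e]
    have hn0 : (0 : ℝ) ≤ n := Nat.cast_nonneg n
    have h3 := mul_le_mul_of_nonneg_right h2.1 hn0
    have h4 := mul_le_mul_of_nonneg_right h2.2 hn0
    have h5 : δ * n ≤ δ * (n * n) := by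
      rcases Nat.eq_zero_or_pos n with rfl | hn
      · simp
      · exact mul_le_mul_of_nonneg_left (le_mul_of_one_le_left hn0 (by exact_mod_cast hn)) hδ
    refine abs_le.2 ⟨?_, ?_⟩ <;> linarith

lemma mul_self_sub_nonneg (m : ℤ) : 0 ≤ (m : ℝ) * ((m : ℝ) - 1) := by
  have : 0 ≤ m * (m - 1) := by
    rcases le_or_gt m 0 with h | h
    · exact mul_nonneg_of_nonpos_of_nonpos h (by omega)
    · exact mul_nonneg h.le (by omega)
  exact_mod_cast this

/-! ### The remainder -/

/-- The jump `F(ω₊ᵏ) - F(ω₋ᵏ)` of an integer-valued functional. -/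
def jump (F : Config → ℕ) (k : ℕ) (ω : Config) : ℤ :=
  (F (Function.update ω k 1) : ℤ) - F (Function.update ω k (-1))

lemma grad_natCast (p : ℕ → unitInterval) (F : Config → ℕ) (k : ℕ) (ω : Config) :
    grad p k (fun ω => (F ω : ℝ)) ω = sigma p k * jump F k ω := by
  simp [grad, jump]

lemma negGradInvL_update (p : ℕ → unitInterval) (G : Config → ℝ) (k : ℕ) (ω : Config) (a : ℤˣ) :
    negGradInvL p G k (Function.update ω k a) = negGradInvL p G k ω := by
  simp only [negGradInvL, grad_update]

/-- The remainder averages the two Taylor bounds over the `k`-th coordinate. -/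
lemma remainder_eq (p : ℕ → unitInterval) (F : Config → ℕ) (k : ℕ) (ω : Config) :
    remainder p (fun ω => (F ω : ℝ)) k ω =
      sigma p k ^ 2 * |negGradInvL p (fun ω => (F ω : ℝ)) k ω| *
        (p k * ((jump F k ω : ℝ) * (jump F k ω + 1)) +
          (1 - p k) * ((jump F k ω : ℝ) * (jump F k ω - 1))) := by
  rw [remainder, grad_natCast]
  ring

lemma mul_self_add_nonneg (m : ℤ) : 0 ≤ (m : ℝ) * ((m : ℝ) + 1) := by
  have := mul_self_sub_nonneg (-m)
  push_cast at this
  linarith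

lemma remainder_nonneg (p : ℕ → unitInterval) (F : Config → ℕ) (k : ℕ) (ω : Config) :
    0 ≤ remainder p (fun ω => (F ω : ℝ)) k ω := by
  rw [remainder_eq]
  have h1 := mul_self_sub_nonneg (jump F k ω)
  have h2 := mul_self_add_nonneg (jump F k ω)
  have h3 : (0 : ℝ) ≤ p k := (p k).2.1
  have h4 : (0 : ℝ) ≤ 1 - p k := by linarith [(p k).2.2]
  positivity

/-- The error `Dₖ f(F) - Δf(F) DₖF` in the chain rule. -/
def chainError (p : ℕ → unitInterval) (f : ℕ → ℝ) (F : Config → ℕ) (k : ℕ) (ω : Config) : ℝ :=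
  grad p k (fun ω => f (F ω)) ω - (f (F ω + 1) - f (F ω)) * grad p k (fun ω => (F ω : ℝ)) ω

lemma abs_chainError_update_neg_one_le (hp : ∀ k, 0 < (p k : ℝ) ∧ (p k : ℝ) < 1) {f : ℕ → ℝ}
    {δ : ℝ} (hf : ∀ j, |f (j + 1) - f j| ≤ δ) (F : Config → ℕ) (k : ℕ) (ω : Config) :
    |chainError p f F k (Function.update ω k (-1))| ≤
      sigma p k * (δ * ((jump F k ω : ℝ) * (jump F k ω - 1))) := by
  have hσ := (sigma_pos hp k).le
  have h := abs_taylor_le hf (F (Function.update ω k 1)) (F (Function.update ω k (-1)))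
  rw [chainError, grad_update, grad_update, grad_natCast]
  simp only [grad, jump]
  push_cast
  refine le_trans (le_of_eq ?_) (mul_le_mul_of_nonneg_left h hσ)
  rw [← abs_of_nonneg hσ, ← abs_mul, abs_of_nonneg hσ]
  congr 1
  ring

lemma abs_chainError_update_one_le (hp : ∀ k, 0 < (p k : ℝ) ∧ (p k : ℝ) < 1) {f : ℕ → ℝ}
    {δ : ℝ} (hf : ∀ j, |f (j + 1) - f j| ≤ δ) (F : Config → ℕ) (k : ℕ) (ω : Config) :
    |chainError p f F k (Function.update ω k 1)| ≤
      sigma p k * (δ * ((jump F k ω : ℝ) * (jump F k ω + 1))) := by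
  have hσ := (sigma_pos hp k).le
  have h := abs_taylor_le hf (F (Function.update ω k (-1))) (F (Function.update ω k 1))
  rw [chainError, grad_update, grad_update, grad_natCast]
  simp only [grad, jump]
  push_cast
  refine le_trans (le_of_eq ?_) ((mul_le_mul_of_nonneg_left h hσ).trans_eq (by ring))
  rw [← abs_of_nonneg hσ, ← abs_mul, abs_of_nonneg hσ, ← abs_neg]
  congr 1
  ring

/-- The last term of the bound arises by averaging the two Taylor bounds over the `k`-th coordinate,
on which neither the jump nor `Dₖ L⁻¹(F - E[F])` depends. -/
lemma lintegral_chainError_le (hp : ∀ k, 0 < (p k : ℝ) ∧ (p k : ℝ) < 1) {f : ℕ → ℝ}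
    {δ : ℝ} (hf : ∀ j, |f (j + 1) - f j| ≤ δ) (F : Config → ℕ) (k : ℕ)
    (hm : AEMeasurable (fun ω => chainError p f F k ω *
      negGradInvL p (fun ω => (F ω : ℝ)) k ω) (law p))
    (hj : AEMeasurable (fun ω => (jump F k ω : ℝ)) (law p))
    (hv : AEMeasurable (negGradInvL p (fun ω => (F ω : ℝ)) k) (law p)) :
    ∫⁻ ω, ‖chainError p f F k ω * negGradInvL p (fun ω => (F ω : ℝ)) k ω‖ₑ ∂law p ≤
      ENNReal.ofReal δ * (ENNReal.ofReal (1 / √((p k : ℝ) * (1 - (p k : ℝ)))) *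
        ∫⁻ ω, ENNReal.ofReal (remainder p (fun ω => (F ω : ℝ)) k ω) ∂law p) := by
  have hσ := sigma_pos hp k
  have hδ : 0 ≤ δ := (abs_nonneg _).trans (hf 0)
  have h3 : (0 : ℝ) ≤ p k := (p k).2.1
  have h4 : (0 : ℝ) ≤ 1 - p k := by linarith [(p k).2.2]
  set V : Config → ℝ := negGradInvL p (fun ω => (F ω : ℝ)) k with hV
  set A : Config → ℝ := fun ω =>
    sigma p k * (δ * ((jump F k ω : ℝ) * (jump F k ω + 1))) * |V ω| with hA
  set B : Config → ℝ := fun ω =>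
    sigma p k * (δ * ((jump F k ω : ℝ) * (jump F k ω - 1))) * |V ω| with hB
  have hA0 : ∀ ω, 0 ≤ A ω := fun ω => by
    have := mul_self_add_nonneg (jump F k ω)
    positivity
  have hB0 : ∀ ω, 0 ≤ B ω := fun ω => by
    have := mul_self_sub_nonneg (jump F k ω)
    positivity
  have hAm : AEMeasurable A (law p) :=
    (((hj.mul (hj.add_const 1)).const_mul δ).const_mul _).mul hv.abs
  have hBm : AEMeasurable B (law p) :=
    (((hj.mul (hj.sub_const 1)).const_mul δ).const_mul _).mul hv.abs
  have hup : ∀ (ω : Config) (a : ℤˣ), V (Function.update ω k a) = V ω := fun ω a =>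
    negGradInvL_update p _ k ω a
  have hrem : ∀ ω, p k * A ω + (1 - p k) * B ω =
      δ * (1 / √((p k : ℝ) * (1 - (p k : ℝ))) * remainder p (fun ω => (F ω : ℝ)) k ω) :=
    fun ω => by
      rw [remainder_eq, ← sigma, hA, hB]
      field_simp
      ring
  calc ∫⁻ ω, ‖chainError p f F k ω * V ω‖ₑ ∂law p
      = ENNReal.ofReal (p k) * ∫⁻ ω, ‖chainError p f F k (Function.update ω k 1) * V ω‖ₑ ∂law p +
        ENNReal.ofReal (1 - p k) *
          ∫⁻ ω, ‖chainError p f F k (Function.update ω k (-1)) * V ω‖ₑ ∂law p := by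
        rw [lintegral_eq_resample hp k hm.enorm]
        simp_rw [hup]
    _ ≤ ENNReal.ofReal (p k) * ∫⁻ ω, ENNReal.ofReal (A ω) ∂law p +
        ENNReal.ofReal (1 - p k) * ∫⁻ ω, ENNReal.ofReal (B ω) ∂law p := by
        gcongr with ω ω
        · rw [Real.enorm_eq_ofReal_abs, abs_mul]
          exact ENNReal.ofReal_le_ofReal (mul_le_mul_of_nonneg_right
            (abs_chainError_update_one_le hp hf F k ω) (abs_nonneg _))
        · rw [Real.enorm_eq_ofReal_abs, abs_mul]
          exact ENNReal.ofReal_le_ofReal (mul_le_mul_of_nonneg_right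
            (abs_chainError_update_neg_one_le hp hf F k ω) (abs_nonneg _))
    _ = ∫⁻ ω, ENNReal.ofReal (p k * A ω + (1 - p k) * B ω) ∂law p := by
        rw [← lintegral_const_mul'' _ hAm.ennreal_ofReal, ← lintegral_const_mul'' _ hBm.ennreal_ofReal,
          ← lintegral_add_left' (hAm.ennreal_ofReal.const_mul _)]
        refine lintegral_congr fun ω => ?_
        rw [ENNReal.ofReal_add (mul_nonneg h3 (hA0 ω)) (mul_nonneg h4 (hB0 ω)),
          ENNReal.ofReal_mul h3, ENNReal.ofReal_mul h4]
    _ = _ := by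
        simp_rw [hrem, ENNReal.ofReal_mul hδ,
          ENNReal.ofReal_mul (one_div_nonneg.2 (Real.sqrt_nonneg _))]
        rw [lintegral_const_mul' _ _ ENNReal.ofReal_ne_top,
          lintegral_const_mul' _ _ ENNReal.ofReal_ne_top]

/-! ### The Stein identity for Rademacher functionals -/

lemma summable_integral_sq_grad_of_domD (hp : ∀ k, 0 < (p k : ℝ) ∧ (p k : ℝ) < 1)
    {G : Config → ℝ} (hG : DomD p G) : Summable fun k => ∫ ω, grad p k G ω ^ 2 ∂law p := by
  have hm : ∀ k, AEMeasurable (fun ω => ENNReal.ofReal (grad p k G ω ^ 2)) (law p) := fun k =>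
    ((memLp_grad hp k hG.1).aestronglyMeasurable.aemeasurable.pow_const 2).ennreal_ofReal
  have h := hG.2
  rw [lintegral_tsum hm] at h
  have e : ∀ k, ∫ ω, grad p k G ω ^ 2 ∂law p =
      (∫⁻ ω, ENNReal.ofReal (grad p k G ω ^ 2) ∂law p).toReal := fun k =>
    integral_eq_lintegral_of_nonneg_ae (Filter.Eventually.of_forall fun ω => sq_nonneg _)
      (memLp_grad hp k hG.1).integrable_sq.aestronglyMeasurable
  simp_rw [e]
  exact ENNReal.summable_toReal h.ne

lemma memLp_sub_mean {G : Config → ℝ} (hG : MemLp G 2 (law p)) :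
    MemLp (fun ω => G ω - ∫ ω', G ω' ∂law p) 2 (law p) := hG.sub (memLp_const _)

lemma memLp_negGradInvL (hp : ∀ k, 0 < (p k : ℝ) ∧ (p k : ℝ) < 1) (G : Config → ℝ) (k : ℕ) :
    MemLp (negGradInvL p G k) 2 (law p) := (memLp_grad hp k (Lp.memLp _)).neg

lemma summable_integral_sq_negGradInvL (hp : ∀ k, 0 < (p k : ℝ) ∧ (p k : ℝ) < 1)
    {G : Config → ℝ} (hG : MemLp G 2 (law p)) :
    Summable fun k => ∫ ω, negGradInvL p G k ω ^ 2 ∂law p := by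
  simp only [negGradInvL, neg_sq]
  exact summable_integral_sq_grad_invL hp (memLp_sub_mean hG)

/-- The products `DₖH · (-DₖL⁻¹(G - E[G]))` have summable `L¹` norms. -/
lemma summable_integral_norm_grad_mul (hp : ∀ k, 0 < (p k : ℝ) ∧ (p k : ℝ) < 1)
    {G H : Config → ℝ} (hG : MemLp G 2 (law p)) (hH : MemLp H 2 (law p))
    (hsH : Summable fun k => ∫ ω, grad p k H ω ^ 2 ∂law p) :
    Summable fun k => ∫ ω, ‖grad p k H ω * negGradInvL p G k ω‖ ∂law p :=
  summable_integral_abs_mul (fun k => memLp_grad hp k hH) (memLp_negGradInvL hp G) hsH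
    (summable_integral_sq_negGradInvL hp hG)

lemma integrable_grad_mul (hp : ∀ k, 0 < (p k : ℝ) ∧ (p k : ℝ) < 1)
    {G H : Config → ℝ} (hH : MemLp H 2 (law p)) (k : ℕ) :
    Integrable (fun ω => grad p k H ω * negGradInvL p G k ω) (law p) :=
  (memLp_grad hp k hH).integrable_mul (memLp_negGradInvL hp G k)

/-- The covariance formula `E[(G - E[G]) H] = E[⟨DH, -DL⁻¹(G - E[G])⟩]`. -/
lemma integral_sub_mean_mul (hp : ∀ k, 0 < (p k : ℝ) ∧ (p k : ℝ) < 1)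
    {G H : Config → ℝ} (hG : MemLp G 2 (law p)) (hH : MemLp H 2 (law p))
    (hsH : Summable fun k => ∫ ω, grad p k H ω ^ 2 ∂law p) :
    ∫ ω, (G ω - ∫ ω', G ω' ∂law p) * H ω ∂law p =
      ∫ ω, ∑' k, grad p k H ω * negGradInvL p G k ω ∂law p := by
  have h0 : ∫ ω, (G ω - ∫ ω', G ω' ∂law p) ∂law p = 0 := by
    rw [integral_sub (hG.integrable one_le_two) (integrable_const _)]
    simp
  exact (hasSum_integral_grad_mul_neg_grad_invL hp (memLp_sub_mean hG) h0 hH).unique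
    (hasSum_integral_of_summable_integral_norm (fun k => integrable_grad_mul hp hH k)
      (summable_integral_norm_grad_mul hp hG hH hsH))

lemma aemeasurable_of_natCast {F : Config → ℕ} (hF : MemLp (fun ω => (F ω : ℝ)) 2 (law p)) :
    AEMeasurable F (law p) := by
  have := Nat.measurable_floor.comp_aemeasurable hF.aestronglyMeasurable.aemeasurable
  refine this.congr (Filter.Eventually.of_forall fun ω => ?_)
  simp

lemma memLp_comp_natCast {F : Config → ℕ} (hF : MemLp (fun ω => (F ω : ℝ)) 2 (law p))
    {f : ℕ → ℝ} {C : ℝ} (hC : ∀ j, |f j| ≤ C) (q : ℝ≥0∞) :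
    MemLp (fun ω => f (F ω)) q (law p) :=
  MemLp.of_bound ((measurable_of_countable f).comp_aemeasurable
    (aemeasurable_of_natCast hF)).aestronglyMeasurable C (Filter.Eventually.of_forall fun _ => hC _)

lemma abs_grad_comp_le (hp : ∀ k, 0 < (p k : ℝ) ∧ (p k : ℝ) < 1) {f : ℕ → ℝ} {δ : ℝ}
    (hf : ∀ j, |f (j + 1) - f j| ≤ δ) (F : Config → ℕ) (k : ℕ) (ω : Config) :
    |grad p k (fun ω => f (F ω)) ω| ≤ δ * |grad p k (fun ω => (F ω : ℝ)) ω| := by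
  have hσ := (sigma_pos hp k).le
  simp only [grad, abs_mul, abs_of_nonneg hσ]
  have := mul_le_mul_of_nonneg_left
    (abs_sub_le_mul_abs hf (F (Function.update ω k 1)) (F (Function.update ω k (-1)))) hσ
  linarith

lemma summable_integral_sq_grad_comp (hp : ∀ k, 0 < (p k : ℝ) ∧ (p k : ℝ) < 1)
    {F : Config → ℕ} (hF : DomD p fun ω => (F ω : ℝ)) {f : ℕ → ℝ} {C δ : ℝ}
    (hC : ∀ j, |f j| ≤ C) (hf : ∀ j, |f (j + 1) - f j| ≤ δ) :
    Summable fun k => ∫ ω, grad p k (fun ω => f (F ω)) ω ^ 2 ∂law p := by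
  refine Summable.of_nonneg_of_le (fun k => integral_nonneg fun ω => sq_nonneg _) (fun k => ?_)
    ((summable_integral_sq_grad_of_domD hp hF).mul_left (δ ^ 2))
  rw [← integral_const_mul]
  refine integral_mono (memLp_grad hp k (memLp_comp_natCast hF.1 hC 2)).integrable_sq
    ((memLp_grad hp k hF.1).integrable_sq.const_mul _) fun ω => ?_
  have h := abs_grad_comp_le hp hf F k ω
  calc grad p k (fun ω => f (F ω)) ω ^ 2 = |grad p k (fun ω => f (F ω)) ω| ^ 2 := (sq_abs _).symm
    _ ≤ (δ * |grad p k (fun ω => (F ω : ℝ)) ω|) ^ 2 := pow_le_pow_left₀ (abs_nonneg _) h 2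
    _ = δ ^ 2 * grad p k (fun ω => (F ω : ℝ)) ω ^ 2 := by rw [mul_pow, sq_abs]

lemma chainError_mul (p : ℕ → unitInterval) (f : ℕ → ℝ) (F : Config → ℕ) (k : ℕ) (ω : Config) :
    chainError p f F k ω * negGradInvL p (fun ω => (F ω : ℝ)) k ω =
      grad p k (fun ω => f (F ω)) ω * negGradInvL p (fun ω => (F ω : ℝ)) k ω -
        (f (F ω + 1) - f (F ω)) *
          (grad p k (fun ω => (F ω : ℝ)) ω * negGradInvL p (fun ω => (F ω : ℝ)) k ω) := by
  rw [chainError]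
  ring

/-- Chain rule and covariance formula combined. -/
lemma integral_stein_eq (hp : ∀ k, 0 < (p k : ℝ) ∧ (p k : ℝ) < 1)
    {F : Config → ℕ} (hF : DomD p fun ω => (F ω : ℝ)) {f : ℕ → ℝ} {C δ : ℝ}
    (hC : ∀ j, |f j| ≤ C) (hf : ∀ j, |f (j + 1) - f j| ≤ δ) (lam : ℝ) :
    ∫ ω, (lam * f (F ω + 1) - F ω * f (F ω)) ∂law p =
      ∫ ω, (f (F ω + 1) - f (F ω)) * (lam - innerDL p (fun ω => (F ω : ℝ)) ω) ∂law p +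
      (lam - ∫ ω, (F ω : ℝ) ∂law p) * ∫ ω, f (F ω) ∂law p -
      ∫ ω, ∑' k, chainError p f F k ω * negGradInvL p (fun ω => (F ω : ℝ)) k ω ∂law p := by
  set m := ∫ ω, (F ω : ℝ) ∂law p with hm
  have hF2 := hF.1
  have hH := memLp_comp_natCast hF2 hC 2
  have hHi := hH.integrable one_le_two
  have hD := memLp_comp_natCast hF2 (f := fun j => f (j + 1) - f j) hf 2
  have hDi := hD.integrable one_le_two
  have hsF := summable_integral_norm_grad_mul hp hF2 hF2 (summable_integral_sq_grad_of_domD hp hF)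
  have hsH := summable_integral_norm_grad_mul hp hF2 hH (summable_integral_sq_grad_comp hp hF hC hf)
  have hiF := fun k => integrable_grad_mul (G := fun ω => (F ω : ℝ)) hp hF2 k
  have hiH := fun k => integrable_grad_mul (G := fun ω => (F ω : ℝ)) hp hH k
  have hinner : Integrable (innerDL p fun ω => (F ω : ℝ)) (law p) :=
    integrable_tsum_of_summable_integral_norm hiF hsF
  have hDinner : Integrable (fun ω => (f (F ω + 1) - f (F ω)) *
      innerDL p (fun ω => (F ω : ℝ)) ω) (law p) :=
    hinner.bdd_mul hD.aestronglyMeasurable (Filter.Eventually.of_forall fun ω => hf (F ω))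
  have hHsum := integrable_tsum_of_summable_integral_norm hiH hsH
  have hchain : ∫ ω, ∑' k, chainError p f F k ω * negGradInvL p (fun ω => (F ω : ℝ)) k ω ∂law p =
      ∫ ω, (F ω - m) * f (F ω) ∂law p -
        ∫ ω, (f (F ω + 1) - f (F ω)) * innerDL p (fun ω => (F ω : ℝ)) ω ∂law p := by
    rw [integral_sub_mean_mul hp hF2 hH (summable_integral_sq_grad_comp hp hF hC hf),
      ← integral_sub hHsum hDinner]
    refine integral_congr_ae ?_
    filter_upwards [ae_summable_of_summable_integral_norm hiF hsF,
      ae_summable_of_summable_integral_norm hiH hsH] with ω h1 h2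
    simp_rw [chainError_mul]
    rw [h2.tsum_sub (h1.mul_left _), tsum_mul_left, innerDL]
  have hFH : Integrable (fun ω => (F ω - m) * f (F ω)) (law p) :=
    (memLp_sub_mean hF2).integrable_mul hH
  have e1 : ∀ ω, lam * f (F ω + 1) - F ω * f (F ω) =
      lam * (f (F ω + 1) - f (F ω)) + (lam - m) * f (F ω) - (F ω - m) * f (F ω) := fun ω => by ring
  have e2 : ∀ ω, (f (F ω + 1) - f (F ω)) * (lam - innerDL p (fun ω => (F ω : ℝ)) ω) =
      lam * (f (F ω + 1) - f (F ω)) -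
        (f (F ω + 1) - f (F ω)) * innerDL p (fun ω => (F ω : ℝ)) ω := fun ω => by ring
  have hadd : Integrable (fun ω => lam * (f (F ω + 1) - f (F ω)) + (lam - m) * f (F ω)) (law p) :=
    (hDi.const_mul lam).add (hHi.const_mul _)
  simp_rw [e1, e2]
  rw [hchain, integral_sub hadd hFH,
    integral_add (hDi.const_mul lam) (hHi.const_mul _), integral_sub (hDi.const_mul lam) hDinner,
    integral_const_mul (lam - m)]
  ring

/-- The bound for a single test function `f`. -/
lemma ofReal_abs_integral_stein_le (hp : ∀ k, 0 < (p k : ℝ) ∧ (p k : ℝ) < 1)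
    {F : Config → ℕ} (hF : DomD p fun ω => (F ω : ℝ)) {f : ℕ → ℝ} {C δ : ℝ}
    (hC : ∀ j, |f j| ≤ C) (hf : ∀ j, |f (j + 1) - f j| ≤ δ) (lam : ℝ) :
    ENNReal.ofReal |∫ ω, (lam * f (F ω + 1) - F ω * f (F ω)) ∂law p| ≤
      ENNReal.ofReal (C * |lam - ∫ ω, (F ω : ℝ) ∂law p|)
      + ENNReal.ofReal (δ * ∫ ω, |lam - innerDL p (fun ω => (F ω : ℝ)) ω| ∂law p)
      + ENNReal.ofReal δ * ∑' k, ENNReal.ofReal (1 / √((p k : ℝ) * (1 - (p k : ℝ)))) *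
          ∫⁻ ω, ENNReal.ofReal (remainder p (fun ω => (F ω : ℝ)) k ω) ∂law p := by
  have hF2 := hF.1
  have hδ : 0 ≤ δ := (abs_nonneg _).trans (hf 0)
  have hC0 : 0 ≤ C := (abs_nonneg _).trans (hC 0)
  have hH := memLp_comp_natCast hF2 hC 2
  have hD := memLp_comp_natCast hF2 (f := fun j => f (j + 1) - f j) hf 2
  have hinner : Integrable (innerDL p fun ω => (F ω : ℝ)) (law p) :=
    integrable_tsum_of_summable_integral_norm
      (fun k => integrable_grad_mul (G := fun ω => (F ω : ℝ)) hp hF2 k)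
      (summable_integral_norm_grad_mul hp hF2 hF2 (summable_integral_sq_grad_of_domD hp hF))
  rw [integral_stein_eq hp hF hC hf lam]
  set I₁ := ∫ ω, (f (F ω + 1) - f (F ω)) * (lam - innerDL p (fun ω => (F ω : ℝ)) ω) ∂law p
  set I₂ := ∫ ω, f (F ω) ∂law p
  set I₃ := ∫ ω, ∑' k, chainError p f F k ω * negGradInvL p (fun ω => (F ω : ℝ)) k ω ∂law p
  set m := ∫ ω, (F ω : ℝ) ∂law p
  have h1 : |I₁| ≤ δ * ∫ ω, |lam - innerDL p (fun ω => (F ω : ℝ)) ω| ∂law p := by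
    rw [← integral_const_mul]
    refine (Real.norm_eq_abs I₁).symm.trans_le ?_
    refine norm_integral_le_of_norm_le (((integrable_const lam).sub hinner).abs.const_mul δ)
      (Filter.Eventually.of_forall fun ω => ?_)
    rw [Real.norm_eq_abs, abs_mul]
    exact mul_le_mul_of_nonneg_right (hf _) (abs_nonneg _)
  have h2 : |(lam - m) * I₂| ≤ C * |lam - m| := by
    rw [abs_mul, mul_comm]
    refine mul_le_mul_of_nonneg_right ?_ (abs_nonneg _)
    have := norm_integral_le_of_norm_le_const (μ := law p) (f := fun ω => f (F ω))
      (Filter.Eventually.of_forall fun ω => hC (F ω))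
    simpa using this
  have hmeas : ∀ k, AEStronglyMeasurable
      (fun ω => chainError p f F k ω * negGradInvL p (fun ω => (F ω : ℝ)) k ω) (law p) := fun k =>
    ((memLp_grad hp k hH).aestronglyMeasurable.sub
      (hD.aestronglyMeasurable.mul (memLp_grad hp k hF2).aestronglyMeasurable)).mul
      (memLp_negGradInvL hp _ k).aestronglyMeasurable
  have h3 : ENNReal.ofReal |I₃| ≤ ENNReal.ofReal δ *
      ∑' k, ENNReal.ofReal (1 / √((p k : ℝ) * (1 - (p k : ℝ)))) *
        ∫⁻ ω, ENNReal.ofReal (remainder p (fun ω => (F ω : ℝ)) k ω) ∂law p := by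
    rw [← Real.enorm_eq_ofReal_abs, ← ENNReal.tsum_mul_left]
    refine (enorm_integral_le_lintegral_enorm _).trans ?_
    refine (lintegral_mono fun ω => enorm_tsum_le_tsum_enorm).trans ?_
    rw [lintegral_tsum fun k => (hmeas k).enorm]
    refine ENNReal.tsum_le_tsum fun k => ?_
    have hj : AEMeasurable (fun ω => (jump F k ω : ℝ)) (law p) := by
      have := (memLp_update hp k 1 hF2).aestronglyMeasurable.aemeasurable.sub
        (memLp_update hp k (-1) hF2).aestronglyMeasurable.aemeasurable
      refine this.congr (Filter.Eventually.of_forall fun ω => ?_)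
      simp [jump]
    exact lintegral_chainError_le hp hf F k (hmeas k).aemeasurable hj
      (memLp_negGradInvL hp _ k).aestronglyMeasurable.aemeasurable
  have hsplit : |I₁ + (lam - m) * I₂ - I₃| ≤ |(lam - m) * I₂| + |I₁| + |I₃| := by
    rw [add_comm I₁]
    exact (abs_sub _ _).trans (add_le_add_left (abs_add_le _ _) _)
  refine (ENNReal.ofReal_le_ofReal hsplit).trans ?_
  rw [ENNReal.ofReal_add (by positivity) (abs_nonneg _),
    ENNReal.ofReal_add (abs_nonneg _) (abs_nonneg _)]
  exact add_le_add (add_le_add (ENNReal.ofReal_le_ofReal h2) (ENNReal.ofReal_le_ofReal h1)) h3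

/-! ### Total variation distance -/

lemma poissonMeasure_real_eq_mean (lam : ℝ≥0) (A : Set ℕ) :
    (poissonMeasure lam).real A = SteinPoisson.mean lam (A.indicator fun _ => 1) := by
  have h := integral_poissonMeasure lam (A.indicator fun _ => (1 : ℝ))
  rw [integral_indicator (MeasurableSet.of_discrete : MeasurableSet A), setIntegral_const,
    smul_eq_mul, mul_one] at h
  rw [h]
  exact tsum_congr fun n => rfl

lemma map_real_eq_integral {F : Config → ℕ} (hF : AEMeasurable F (law p)) (A : Set ℕ) :
    ((law p).map F).real A = ∫ ω, A.indicator (fun _ => (1 : ℝ)) (F ω) ∂law p := by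
  rw [← integral_map hF (measurable_of_countable _).aestronglyMeasurable,
    integral_indicator (MeasurableSet.of_discrete : MeasurableSet A), setIntegral_const,
    smul_eq_mul, mul_one]

/-- If `b = ∞` there is nothing to prove; otherwise the bound makes the supremum in `dTV` one of a
bounded family. -/
lemma ofReal_dTV_le {μ ν : Measure ℕ} {b : ℝ≥0∞}
    (h : ∀ A : Set ℕ, ENNReal.ofReal |μ.real A - ν.real A| ≤ b) : ENNReal.ofReal (dTV μ ν) ≤ b := by
  rcases eq_or_ne b ∞ with rfl | hb
  · exact le_top
  · refine ENNReal.ofReal_le_of_le_toReal (ciSup_le fun A => ?_)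
    exact (ENNReal.ofReal_le_iff_le_toReal hb).1 (h A)

end Rademacher

end

theorem corollary3p3 (p : ℕ → unitInterval) (hp : ∀ k, 0 < (p k : ℝ) ∧ (p k : ℝ) < 1)
    (F : Rademacher.Config → ℕ) (hF : Rademacher.DomD p (fun ω => (F ω : ℝ)))
    (lam : ℝ≥0) (hlam : 0 < lam) :
    -- the inner product is almost surely an absolutely convergent series, and integrable
    (∀ᵐ ω ∂(Rademacher.law p), Summable fun k =>
      Rademacher.grad p k (fun ω => (F ω : ℝ)) ω *
        Rademacher.negGradInvL p (fun ω => (F ω : ℝ)) k ω) ∧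
    Integrable (Rademacher.innerDL p fun ω => (F ω : ℝ)) (Rademacher.law p) ∧
    -- the expectations in the last sum are those of nonnegative random variables
    (∀ k ω, 0 ≤ Rademacher.remainder p (fun ω => (F ω : ℝ)) k ω) ∧
    (∀ k, AEMeasurable (Rademacher.remainder p (fun ω => (F ω : ℝ)) k) (Rademacher.law p)) ∧
    -- the bound, in `[0, ∞]`
    ENNReal.ofReal (Rademacher.dTV ((Rademacher.law p).map F) (poissonMeasure lam)) ≤
      ENNReal.ofReal (min 1 √(2 / (Real.exp 1 * (lam : ℝ))) *
        |(lam : ℝ) - ∫ ω, (F ω : ℝ) ∂(Rademacher.law p)|)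
      + ENNReal.ofReal ((1 - Real.exp (-(lam : ℝ))) / (lam : ℝ) *
        ∫ ω, |(lam : ℝ) - Rademacher.innerDL p (fun ω => (F ω : ℝ)) ω| ∂(Rademacher.law p))
      + ENNReal.ofReal ((1 - Real.exp (-(lam : ℝ))) / (lam : ℝ)) *
          ∑' k, ENNReal.ofReal (1 / √((p k : ℝ) * (1 - (p k : ℝ)))) *
            ∫⁻ ω, ENNReal.ofReal (Rademacher.remainder p (fun ω => (F ω : ℝ)) k ω)
              ∂(Rademacher.law p) := by
  have hF2 := hF.1
  have hs := Rademacher.summable_integral_norm_grad_mul hp hF2 hF2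
    (Rademacher.summable_integral_sq_grad_of_domD hp hF)
  have hi := fun k => Rademacher.integrable_grad_mul (G := fun ω => (F ω : ℝ)) hp hF2 k
  refine ⟨Rademacher.ae_summable_of_summable_integral_norm hi hs,
    Rademacher.integrable_tsum_of_summable_integral_norm hi hs,
    Rademacher.remainder_nonneg p F, fun k => ?_, ?_⟩
  · have hg := (Rademacher.memLp_grad hp k hF2).aestronglyMeasurable.aemeasurable
    have hv := (Rademacher.memLp_negGradInvL hp (fun ω => (F ω : ℝ)) k).aestronglyMeasurable
    exact (hg.mul (hg.add_const _)).mul hv.aemeasurable.abs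
  · refine Rademacher.ofReal_dTV_le fun A => ?_
    have hlam' : (0 : ℝ) < lam := hlam
    set h : ℕ → ℝ := A.indicator fun _ => 1 with hh
    have h0 : ∀ r, 0 ≤ h r := fun r => Set.indicator_nonneg (fun _ _ => zero_le_one) r
    have h1 : ∀ r, h r ≤ 1 := fun r => Set.indicator_le_self' (fun _ _ => zero_le_one) r
    have hb : ∀ r, |h r| ≤ 1 := fun r => abs_le.2 ⟨by linarith [h0 r], h1 r⟩
    have key := Rademacher.ofReal_abs_integral_stein_le hp hF
      (SteinPoisson.abs_steinSol_le hlam' h0 h1)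
      (SteinPoisson.abs_steinSol_succ_sub_le hlam' h0 h1) lam
    simp_rw [SteinPoisson.steinSol_equation (lam : ℝ) hb] at key
    rw [integral_sub ((Rademacher.memLp_comp_natCast hF2 hb 1).integrable le_rfl)
      (integrable_const _), integral_const, probReal_univ, one_smul, hh,
      ← Rademacher.map_real_eq_integral (Rademacher.aemeasurable_of_natCast hF2),
      ← Rademacher.poissonMeasure_real_eq_mean] at key
    exact key
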